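/- **Model.** There are $n\ge 1$ participants $S=\{P_1,\dots,P_n\}$, acting in synchronous rounds. In each round an environment $\mathcal Z$ activates the participants one after the other with inputs, and each participant may ask a random oracle up to $q$ queries; each query tries to extend a chosen chain by a new block, has cost $c\ge 0$, and is successful (gives a valid block extending that chain) with fixed probability $p\in[0,1]$, independently of all other queries. Let $s=p\,q\,n$ be the expected number of solutions per round. An honest participant asks all its $q$ queries, trying to extend its local chain, and then diffuses its local chain, extended by the first block it found (if any). At the end of the round every participant first receives, in an order chosen by the adversary, chains chosen by the adversary, and then all chains diffused by honest participants in that round; it adopts the longest valid chain, keeping its old chain unless a strictly longer one arrives and preferring among the longest ones the first received (its own new block also takes effect only through this step). A *static adversary with fixed cost* fixes in the beginning a set $T\subseteq S$ that it controls and, for every $P_i\in T$, the number (at most $q$) of queries that $P_i$ asks in each round; otherwise its (randomized) strategy is arbitrary and may depend on everything that has happened so far. $H_T$ denotes the adversary that controls $T$ and follows the protocol, but whose chains are delivered first. Let $r=r(\kappa)\neq 0$ be polynomial in the security parameter $\kappa\ge 1$; an environment is *$r$-admissible* if it terminates the execution after $r(\kappa)$ rounds. For a final state $\mathcal E$ of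 an execution and $P_j\notin T$, let $R_T^j(\mathcal E)$ be the sum of the rewards of the blocks in the local chain of $P_j$ that were produced by $T$, where the reward of a block is the block reward in force in the round in which it was produced, and let $C_i(\mathcal E)$ be $c$ times the number of queries asked by $P_i$. The utility *absolute rewards minus absolute cost* is $U_T^j(\mathcal E)=R_T^j(\mathcal E)-\sum_{i:P_i\in T}C_i(\mathcal E)$; let $U_T^{\max}$ and $U_T^{\min}$ be its maximum and minimum over $P_j\in S\setminus T$. The protocol is a *$(t,\epsilon,\epsilon')$-EVP* (equilibrium with virtual payoffs) if for every static adversary $\mathcal A$ with fixed cost (in particular every such probabilistic polynomial-time one), controlling a set $T$ of at most $t$ participants, and every $r$-admissible environment $\mathcal Z$, $$U_T^{\max}(\mathcal E'_{\mathcal Z,\mathcal A})\le U_T^{\min}(\mathcal E_{\mathcal Z,H_T})+\epsilon\,\bigl|U_T^{\min}(\mathcal E_{\mathcal Z,H_T})\bigr|+\epsilon'$$ holds with overwhelming probability in $\kappa$ (that is, except with probability negligible in $\kappa$), where $\mathcal E_{\mathcal Z,H_T}$ and $\mathcal E'_{\mathcal Z,\mathcal A}$ are independent executions with the same environment and with adversary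 $H_T$ and $\mathcal A$ respectively. **Theorem.** Let $l>0$ be a constant. Assume that the block reward takes successively the values $w_0,\dots,w_m$ during the execution (the number $m\ge 0$ of changes, the rounds of the changes and the $w_j$ may depend on $\kappa$), and that each of them is in force for at least $l\kappa$ rounds: at least $l\kappa$ rounds pass before the first change, between consecutive changes, and between the last change and the end of the execution (if $m=0$, the execution lasts at least $l\kappa$ rounds). Let $\phi\in(0,1-s)$ be such that $$c<\frac{p\,w_j\,\phi}{1+p\,q\,(n-1)}\qquad\text{for all } j\in\{0,\dots,m\}.$$ Then for every $\delta_1\in(0,0.25)$ such that $$c\le\frac{p\,w_j\,(1-\delta_1)\,\phi}{1+p\,q\,(n-1)}\quad\text{for all } j\in\{0,\dots,m\}\qquad\text{and}\qquad 4\delta_1(1+s)+s<1-\phi,$$ Bitcoin with fixed target in the synchronous setting is an $\left(n-1,\ \dfrac{4\delta_1(1+s)+s}{1-\phi},\ 0\right)$-EVP for the utility absolute rewards minus absolute cost. Here $n,q,p,c,l,\phi,\delta_1$ do not depend on $\kappa$, and the conditions on the $w_j$ are required for every $\kappa$. -/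

import Mathlib

open MeasureTheory

namespace BitcoinEVP

/-! ### Blocks, chains and the state of an execution

There are `n` participants, indexed by `Fin n`, and rounds are numbered `0, 1, 2, …`. -/

/-- Messages and block contents (for example transactions). -/
abbrev Msg := List Bool

/-- A block: the round in which it was produced, its producer, the number of the oracle query (of
that participant in that round) which solved it, and its contents. -/
structure Block (n : ℕ) where
  round : ℕ
  producer : Fin n
  query : ℕ
  data : Msg
deriving DecidableEq

/-- A chain of blocks, newest block first; the empty list is the genesis chain. -/
abbrev Chain (n : ℕ) := List (Block n)

/-- The things that happen in an execution, as they are recorded in the transcript. -/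
inductive Event (n : ℕ) where
  /-- the environment activates participant `i` with input `x` (if `i` is corrupted, the input goes
  to the adversary) -/
  | input (i : Fin n) (x : Msg)
  /-- participant `i` asks the random oracle its `k`-th query of the round, trying to extend the
  chain `parent` by a block with contents `data` -/
  | query (i : Fin n) (k : ℕ) (parent : Chain n) (data : Msg) (success : Bool)
  /-- the honest participant `i` hands the chain `C` to the Diffuse functionality -/
  | diffuse (i : Fin n) (C : Chain n)
  /-- the adversary, after the activation of the corrupted participant `i`, outputs `y` to the
  environment -/
  | output (i : Fin n) (y : Msg)
  /-- the adversary sends the chains in `L`, in this order, to participant `j` -/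
  | deliver (j : Fin n) (L : List (Chain n))

/-- The state of an execution. -/
structure State (n : ℕ) where
  /-- the current round -/
  round : ℕ
  /-- everything that has happened so far, newest event first -/
  transcript : List (Event n)
  /-- the last input that each participant received from the environment -/
  input : Fin n → Msg
  /-- the local chain of each participant -/
  chain : Fin n → Chain n
  /-- the valid chains that exist so far, in the order of their production: the genesis chain, and
  extensions of valid chains by a block obtained in a successful query -/
  valid : List (Chain n)
  /-- the messages (chains) of the honest participants that the Diffuse functionality holds in the
  current round -/
  pending : List (Chain n)

/-- The state at the beginning: every local chain is the genesis chain. -/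
def State.init (n : ℕ) : State n where
  round := 0
  transcript := []
  input := fun _ => []
  chain := fun _ => []
  valid := [[]]
  pending := []

def State.log {n : ℕ} (st : State n) (e : Event n) : State n :=
  { st with transcript := e :: st.transcript }

/-! ### Environments and adversaries -/

/-- An environment. It fixes in advance the number of rounds after which it terminates the
execution, tosses a number of private coins, and activates the participants with inputs which may
depend on its coins and on all that has happened so far. There is no bound on its computational
power. -/
structure Environment (n : ℕ) where
  rounds : ℕ
  coins : ℕ
  input : (Fin coins → Bool) → State n → Fin n → Msg

/-- A static adversary with fixed cost. In the beginning it fixes the set of the participants it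
controls and the number `asks i ≤ q` of queries that the corrupted participant `i` asks in each
round. Apart from that its strategy is arbitrary: it may depend on its private coins and on all that
has happened so far (in particular on the messages of the honest participants of the current round).
There is no bound on its computational power. -/
structure Adversary (n q : ℕ) where
  corrupted : Finset (Fin n)
  asks : Fin n → ℕ
  asks_le : ∀ i, asks i ≤ q
  coins : ℕ
  /-- the chain that the `k`-th query of the corrupted participant `i` tries to extend, and the
  contents of the new block -/
  query : (Fin coins → Bool) → State n → Fin n → Fin q → Chain n × Msg
  /-- the output to the environment after the activation of the corrupted participant `i` -/
  output : (Fin coins → Bool) → State n → Fin n → Msg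
  /-- the chains that the adversary sends to participant `j` at the end of the round, in the order
  of their delivery; they arrive before the messages of the honest participants -/
  deliver : (Fin coins → Bool) → State n → Fin n → List (Chain n)

/-! ### The execution -/

/-- A participant with local chain `C` that receives the chains of the list `L` one after the other
adopts a received valid chain whenever it is strictly longer than its present one. So it ends up
with the first received one among the longest. -/
def adopt {n : ℕ} (valid : List (Chain n)) (C : Chain n) (L : List (Chain n)) : Chain n :=
  L.foldl (fun C C' => if C' ∈ valid ∧ C.length < C'.length then C' else C) C

/-- The turn of the honest participant `i`; `ans k` says whether the `k`-th query is successful. It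
asks all its `q` queries, trying to extend its local chain by a block that contains its input, and
then gives to the Diffuse functionality its local chain, extended by the first block it found, if it
found any. Its local chain is only updated at the end of the round. -/
def honestTurn {n q : ℕ} (ans : Fin q → Bool) (i : Fin n) (st : State n) : State n :=
  let asked := (List.finRange q).foldl
    (fun st k => st.log (.query i k (st.chain i) (st.input i) (ans k))) st
  match (List.finRange q).find? ans with
  | none =>
    { asked.log (.diffuse i (st.chain i)) with pending := st.pending ++ [st.chain i] }
  | some k =>
    let C : Chain n := ⟨st.round, i, k, st.input i⟩ :: st.chain i
    { asked.log (.diffuse i C) with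
      valid := st.valid ++ [C]
      pending := st.pending ++ [C] }

/-- The turn of the corrupted participant `i`: the adversary asks `asks i` queries. A successful
query on a valid chain gives a new valid chain. -/
def corruptedTurn {n q : ℕ} (A : Adversary n q) (coins : Fin A.coins → Bool) (ans : Fin q → Bool)
    (i : Fin n) (st : State n) : State n :=
  let asked := ((List.finRange q).filter (fun k : Fin q => k.val < A.asks i)).foldl
    (fun st k =>
      let a := A.query coins st i k
      { st.log (.query i k a.1 a.2 (ans k)) with
        valid := if ans k = true ∧ a.1 ∈ st.valid
          then st.valid ++ [⟨st.round, i, k, a.2⟩ :: a.1] else st.valid }) st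
  asked.log (.output i (A.output coins asked i))

/-- The activation of participant `i` by the environment. -/
def turn {n q : ℕ} (Z : Environment n) (A : Adversary n q) (coinsZ : Fin Z.coins → Bool)
    (coinsA : Fin A.coins → Bool) (ans : Fin n → Fin q → Bool) (st : State n) (i : Fin n) :
    State n :=
  let x := Z.input coinsZ st i
  let st' : State n := { st.log (.input i x) with input := Function.update st.input i x }
  if i ∈ A.corrupted then corruptedTurn A coinsA (ans i) i st' else honestTurn (ans i) i st'

/-- The end of a round: every participant receives the chains which the adversary sends to it, and
after them all the messages of the honest participants of this round. -/
def endRound {n q : ℕ} (A : Adversary n q) (coins : Fin A.coins → Bool) (st : State n) : State n :=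
  { st with
    round := st.round + 1
    transcript :=
      ((List.finRange n).map fun j => Event.deliver j (A.deliver coins st j)) ++ st.transcript
    chain := fun j => adopt st.valid (st.chain j) (A.deliver coins st j ++ st.pending)
    pending := [] }

/-- One round: the participants are activated one after the other. -/
def playRound {n q : ℕ} (Z : Environment n) (A : Adversary n q) (coinsZ : Fin Z.coins → Bool)
    (coinsA : Fin A.coins → Bool) (ans : Fin n → Fin q → Bool) (st : State n) : State n :=
  endRound A coinsA ((List.finRange n).foldl (turn Z A coinsZ coinsA ans) st)

/-- The randomness of an execution: whether the `k`-th query of participant `i` in round `m` to the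
random oracle is successful, and the private coins of the environment and of the adversary. -/
abbrev Randomness {n q : ℕ} (Z : Environment n) (A : Adversary n q) : Type :=
  (Fin Z.rounds × Fin n × Fin q → Bool) × (Fin Z.coins → Bool) × (Fin A.coins → Bool)

/-- The final state of the execution. -/
def execution {n q : ℕ} (Z : Environment n) (A : Adversary n q) (ω : Randomness Z A) : State n :=
  (List.finRange Z.rounds).foldl
    (fun st m => playRound Z A ω.2.1 ω.2.2 (fun i k => ω.1 (m, i, k)) st) (State.init n)

/-- The law of `N` independent coins. -/
noncomputable def fairCoins (N : ℕ) : Measure (Fin N → Bool) :=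
  Measure.pi fun _ =>
    ProbabilityTheory.bernoulliMeasure true false (⟨1 / 2, by norm_num, by norm_num⟩ : unitInterval)

/-- The law of the randomness: each query is successful with probability `p`, and queries and coins
are independent. -/
noncomputable def law {n q : ℕ} (p : unitInterval) (Z : Environment n) (A : Adversary n q) :
    Measure (Randomness Z A) :=
  (Measure.pi fun _ => ProbabilityTheory.bernoulliMeasure true false p).prod
    ((fairCoins Z.coins).prod (fairCoins A.coins))

/-- The adversary `H_T`, which controls the set `T` and follows the protocol, but delivers its
messages first: each of its participants asks all its queries, trying to extend its local chain by a
block that contains its input, and sends to everyone its local chain, extended by the first block it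
found in this round, if it found any. It ignores the environment otherwise. -/
def followProtocol {n : ℕ} (q : ℕ) (T : Finset (Fin n)) : Adversary n q where
  corrupted := T
  asks := fun _ => q
  asks_le := fun _ => le_rfl
  coins := 0
  query := fun _ st i _ => (st.chain i, st.input i)
  output := fun _ _ _ => []
  deliver := fun _ st _ =>
    ((List.finRange n).filter (· ∈ T)).map fun i =>
      (st.valid.find? fun C =>
        C.head?.any fun b => decide (b.producer = i ∧ b.round = st.round)).getD (st.chain i)

/-! ### Rewards, costs and utility -/

/-- The block rewards in an execution: there are `changes` many changes, the block reward is
`reward j` from round `start j` on, until round `start (j + 1)`, for `0 ≤ j ≤ changes`. -/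
structure RewardSchedule where
  changes : ℕ
  start : ℕ → ℕ
  reward : ℕ → ℝ

/-- The block reward that is in force in round `i`: the one reached by the changes up to `i`. -/
def RewardSchedule.blockReward (W : RewardSchedule) (i : ℕ) : ℝ :=
  W.reward ((Finset.Icc 1 W.changes).filter fun j => W.start j ≤ i).card

/-- In an execution of `R` rounds, each block reward is in force for at least `L` rounds: there are
at least `L` rounds before the first change, between consecutive changes, and between the last
change and the end of the execution. -/
structure RewardSchedule.ChangesEvery (W : RewardSchedule) (L : ℝ) (R : ℕ) : Prop where
  start_zero : W.start 0 = 0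
  between : ∀ j < W.changes, (W.start j : ℝ) + L ≤ W.start (j + 1)
  after_last : (W.start W.changes : ℝ) + L ≤ R

/-- `R_T^j`: the rewards of the blocks that were produced by `T` and are included in the local chain
of participant `j`. -/
def rewards {n : ℕ} (W : RewardSchedule) (T : Finset (Fin n)) (j : Fin n) (st : State n) : ℝ :=
  ((st.chain j).map fun b => if b.producer ∈ T then W.blockReward b.round else 0).sum

/-- The number of queries that participant `i` has asked. -/
def queriesAsked {n : ℕ} (i : Fin n) (st : State n) : ℕ :=
  st.transcript.countP fun e =>
    match e with
    | .query i' _ _ _ _ => decide (i' = i)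
    | _ => false

/-- `C_i`: the cost of participant `i`, if each query costs `c`. -/
def cost {n : ℕ} (c : ℝ) (i : Fin n) (st : State n) : ℝ := c * queriesAsked i st

/-- A utility: the utility of the coalition `T` in the view of participant `j`. -/
abbrev Utility (n : ℕ) := Finset (Fin n) → Fin n → State n → ℝ

/-- Absolute rewards minus absolute cost. -/
def rewardsMinusCost {n : ℕ} (W : RewardSchedule) (c : ℝ) : Utility n :=
  fun T j st => rewards W T j st - ∑ i ∈ T, cost c i st

/-- The maximum of the utility over the views of the participants outside of `T`. -/
noncomputable def Utility.max {n : ℕ} (U : Utility n) (T : Finset (Fin n)) (st : State n) : ℝ :=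
  ⨆ j : {j : Fin n // j ∉ T}, U T j st

/-- The minimum of the utility over the views of the participants outside of `T`. -/
noncomputable def Utility.min {n : ℕ} (U : Utility n) (T : Finset (Fin n)) (st : State n) : ℝ :=
  ⨅ j : {j : Fin n // j ∉ T}, U T j st

/-! ### Equilibria with virtual payoffs -/

/-- The environment, as a family indexed by the security parameter `κ ≥ 1`, is `r`-admissible: it
terminates the execution after `r κ ≠ 0` rounds, where `r` is a polynomial. -/
structure Admissible {n : ℕ} (r : ℕ → ℕ) (Z : ℕ → Environment n) : Prop where
  polynomial : ∃ P : Polynomial ℝ, ∀ κ : ℕ, 1 ≤ κ → (r κ : ℝ) = P.eval (κ : ℝ)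
  ne_zero : ∀ κ : ℕ, 1 ≤ κ → r κ ≠ 0
  rounds : ∀ κ : ℕ, 1 ≤ κ → (Z κ).rounds = r κ

/-- Bitcoin with fixed target in the synchronous setting, with `n` participants that ask at most `q`
queries per round, each successful with probability `p`, is a `(t, ε, ε')`-equilibrium with virtual
payoffs for the utility `U` (which may depend on the security parameter `κ`) and executions of `r`
rounds, against static adversaries with fixed cost: in two independent executions with the same
environment, the first (`ω.1`) with the adversary `H_T` and the second (`ω.2`) with an arbitrary
adversary that controls the same set `T` of at most `t` participants, the inequality holds with
overwhelming probability in `κ`, that is, fails with negligible probability. -/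
def IsEVP (n q : ℕ) (p : unitInterval) (r : ℕ → ℕ) (U : ℕ → Utility n) (t : ℕ) (ε ε' : ℝ) : Prop :=
  ∀ A : ℕ → Adversary n q, (∀ κ, (A κ).corrupted.card ≤ t) →
  ∀ Z : ℕ → Environment n, Admissible r Z →
    Asymptotics.SuperpolynomialDecay Filter.atTop (fun κ : ℕ => (κ : ℝ)) fun κ : ℕ =>
      ((law p (Z κ) (followProtocol q (A κ).corrupted)).prod (law p (Z κ) (A κ))).real
        {ω | ¬ (U κ).max (A κ).corrupted (execution (Z κ) (A κ) ω.2) ≤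
          (U κ).min (A κ).corrupted
              (execution (Z κ) (followProtocol q (A κ).corrupted) ω.1)
            + ε * |(U κ).min (A κ).corrupted
                (execution (Z κ) (followProtocol q (A κ).corrupted) ω.1)|
            + ε'}

/-- The expected number of solutions per round: each of the `n` participants asks `q` queries, each
of which is successful with probability `p`. -/
def expectedSolutions (n q : ℕ) (p : unitInterval) : ℝ := (p : ℝ) * q * n

end BitcoinEVP

namespace BitcoinEVP

/-! ### Folds with an additive potential -/

/-! Two deterministic estimates, valid for every outcome of the oracle, are compared with the help
of Hoeffding's inequality.

Upper estimate, for an arbitrary adversary. A new valid chain is an old one plus a single block, and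
a block of the coalition costs it a successful query. So in any valid chain the coalition earns at
most the block rewards of all its successful queries (`rewards_execution_le`), whatever its
strategy, while its cost is deterministic because the number of queries is fixed.

Lower estimate, for `H_T`. If all local chains agree when a round begins, they agree when it ends,
and the new common block belongs to the coalition as soon as the coalition has found one, because
its messages arrive first. So it earns the reward of every round in which it is successful
(`le_rewards_execution_followProtocol`).

Let `N = |T| q` and `a = p q (n - 1)`, so that `p N ≤ a ≤ s`. A round is successful with probability
`1 - (1 - p) ^ N ≥ p N / (1 + p N) ≥ p N / (1 + a)`, against an expected number of at most `p N`
successful queries. Up to factors `1 ± δ` the two reward rates thus differ at most by the factor `1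
+ a ≤ 1 + s`. Subtracting the cost enlarges this ratio, but the cost is at most the fraction `φ` of
the lower rate, which accounts for the division by `1 - φ` (`utility_gain_le`).

The rewards may depend on `κ`, so concentration is applied separately to each period of constant
reward, where the reward factors out. A period has at least `l κ` rounds and there are at most `r κ
+ 1` periods; the union bound gives a polynomial times `exp (-C κ)` (`failure_le`). -/

theorem foldl_add_invariant {α β M : Type*} [AddMonoid M] (f : β → α → β) (g : α → M)
    (P : M → β → Prop) (L : List α)
    (step : ∀ x ∈ L, ∀ v st, P v st → P (v + g x) (f st x)) (v : M) (st : β) (h : P v st) :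
    P (v + (L.map g).sum) (L.foldl f st) := by
  induction L generalizing v st with
  | nil => simpa using h
  | cons a L ih =>
    simp only [List.map_cons, List.sum_cons, List.foldl_cons, ← add_assoc]
    exact ih (fun x hx => step x (List.mem_cons_of_mem _ hx)) _ _
      (step a List.mem_cons_self _ _ h)

theorem foldl_invariant {α β : Type*} (f : β → α → β) (P : β → Prop) (L : List α)
    (step : ∀ x ∈ L, ∀ st, P st → P (f st x)) (st : β) (h : P st) : P (L.foldl f st) :=
  foldl_add_invariant (M := ℕ) f 0 (fun _ => P) L (fun x hx _ => step x hx) 0 st h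

/-- Here the invariant may also mention the position in the list, which serves as the round number
when rounds are folded. -/
theorem foldl_finRange_add_invariant {β M : Type*} [AddCommMonoid M] {R : ℕ}
    (f : β → Fin R → β) (g : Fin R → M) (P : ℕ → M → β → Prop)
    (step : ∀ m : Fin R, ∀ v st, P m v st → P (m + 1) (v + g m) (f st m)) (st : β)
    (h : P 0 0 st) : P R (∑ m, g m) ((List.finRange R).foldl f st) := by
  induction R with
  | zero => simpa using h
  | succ R ih =>
    rw [List.finRange_succ_last, List.foldl_append, List.foldl_map, Fin.sum_univ_castSucc]
    exact step (Fin.last R) _ _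
      (ih (fun st m => f st m.castSucc) (fun m => g m.castSucc) fun m => step m.castSucc)

theorem sum_map_filter_finRange {M : Type*} [AddCommMonoid M] {q : ℕ} (P : Fin q → Prop)
    [DecidablePred P] (f : Fin q → M) :
    (((List.finRange q).filter P).map f).sum = ∑ k, if P k then f k else 0 := by
  rw [Fin.sum_univ_def]
  induction List.finRange q with
  | nil => simp
  | cons a L ih => by_cases ha : P a <;> simp [ha, ih]

theorem card_filter_val_lt {q a : ℕ} (h : a ≤ q) :
    (∑ k : Fin q, if k.val < a then 1 else 0) = a := by
  rw [Fin.sum_univ_eq_sum_range (fun k => if k < a then 1 else 0), ← Finset.card_filter]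
  have : (Finset.range q).filter (· < a) = Finset.range a := by
    ext k
    simp only [Finset.mem_filter, Finset.mem_range]
    omega
  rw [this, Finset.card_range]

/-! ### Rewards of chains -/

/-- The rewards of the blocks of `C` that were produced by `T`. -/
def chainReward {n : ℕ} (w : ℕ → ℝ) (T : Finset (Fin n)) (C : Chain n) : ℝ :=
  (C.map fun b => if b.producer ∈ T then w b.round else 0).sum

theorem chainReward_cons {n : ℕ} (w : ℕ → ℝ) (T : Finset (Fin n)) (b : Block n) (C : Chain n) :
    chainReward w T (b :: C) = (if b.producer ∈ T then w b.round else 0) + chainReward w T C := by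
  simp [chainReward]

/-- The reward that the coalition of an adversary could earn in round `m` if all the blocks that it
finds counted. -/
def roundReward {n q : ℕ} (w : ℕ → ℝ) (A : Adversary n q) (m : ℕ)
    (ans : Fin n → Fin q → Bool) : ℝ :=
  ∑ i ∈ A.corrupted, ∑ k : Fin q, if k.val < A.asks i ∧ ans i k = true then w m else 0

theorem adopt_mem_valid {n : ℕ} (valid : List (Chain n)) (C : Chain n) (L : List (Chain n))
    (h : C ∈ valid) : adopt valid C L ∈ valid := by
  refine foldl_invariant _ (· ∈ valid) L (fun x _ st hst => ?_) C h
  split_ifs with hx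
  · exact hx.1
  · exact hst

/-- In round `m`, local chains are valid, and the coalition earns at most `v` in a valid chain. -/
structure RewardBound {n : ℕ} (w : ℕ → ℝ) (T : Finset (Fin n)) (m : ℕ) (v : ℝ) (st : State n) :
    Prop where
  round : st.round = m
  chain : ∀ j, st.chain j ∈ st.valid
  le : ∀ C ∈ st.valid, chainReward w T C ≤ v

/-- Since logging touches only the transcript, the queries of an honest turn can be ignored by every
invariant about chains. -/
theorem foldl_log {n : ℕ} {α : Type*} (e : State n → α → Event n) (L : List α) (st : State n) :
    ∃ t, L.foldl (fun st k => st.log (e st k)) st = { st with transcript := t } := by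
  refine foldl_invariant (fun st k => State.log st (e st k))
    (fun st' => ∃ t, st' = { st with transcript := t }) L ?_ st ⟨_, rfl⟩
  rintro k _ _ ⟨t, rfl⟩
  exact ⟨_, rfl⟩

theorem honestTurn_rewardBound {n q : ℕ} {w : ℕ → ℝ} {T : Finset (Fin n)} {m : ℕ} {v : ℝ}
    {st : State n} (h : RewardBound w T m v st) (ans : Fin q → Bool) {i : Fin n} (hi : i ∉ T) :
    RewardBound w T m v (honestTurn ans i st) := by
  obtain ⟨t, ht⟩ := foldl_log (fun (st : State n) (k : Fin q) =>
    Event.query i k (st.chain i) (st.input i) (ans k)) (List.finRange q) st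
  unfold honestTurn
  simp only [ht]
  split
  · exact ⟨h.round, h.chain, h.le⟩
  · refine ⟨h.round, fun j => List.mem_append_left _ (h.chain j), fun C hC => ?_⟩
    rcases List.mem_append.1 hC with hC | hC
    · exact h.le C hC
    · rw [List.mem_singleton.1 hC, chainReward_cons, if_neg hi, zero_add]
      exact h.le _ (h.chain i)

/-- A successful query adds at most one valid chain, one block longer than a chain to which the
bound `v` already applies. The new block bears the current round, so the bound has to grow by `w m`
at most; other queries leave it true because `w` is nonnegative. -/
theorem corruptedTurn_rewardBound {n q : ℕ} {w : ℕ → ℝ} (hw : ∀ m, 0 ≤ w m)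
    (A : Adversary n q) (coins : Fin A.coins → Bool) {m : ℕ} {v : ℝ} {st : State n}
    (h : RewardBound w A.corrupted m v st) (ans : Fin q → Bool) {i : Fin n} :
    RewardBound w A.corrupted m
      (v + ∑ k : Fin q, if k.val < A.asks i ∧ ans k = true then w m else 0)
      (corruptedTurn A coins ans i st) := by
  simp only [ite_and]
  rw [← sum_map_filter_finRange]
  have key := foldl_add_invariant
    (fun (st : State n) (k : Fin q) =>
      let a := A.query coins st i k
      { st.log (.query i k a.1 a.2 (ans k)) with
        valid := if ans k = true ∧ a.1 ∈ st.valid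
          then st.valid ++ [⟨st.round, i, k, a.2⟩ :: a.1] else st.valid })
    (fun k => if ans k = true then w m else 0) (RewardBound w A.corrupted m)
    ((List.finRange q).filter (fun k : Fin q => k.val < A.asks i)) ?_ v st h
  · exact ⟨key.round, key.chain, key.le⟩
  · intro k _ v st h
    have hv : v ≤ v + if ans k = true then w m else 0 := by
      split_ifs <;> simp [hw m]
    by_cases h1 : ans k = true ∧ (A.query coins st i k).1 ∈ st.valid
    · simp only [if_pos h1, if_pos h1.1]
      refine ⟨h.round, fun j => List.mem_append_left _ (h.chain j), fun C hC => ?_⟩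
      have hm := hw m
      rcases List.mem_append.1 hC with hC | hC
      · linarith [h.le C hC]
      · rw [List.mem_singleton.1 hC, chainReward_cons]
        have hq := h.le _ h1.2
        split_ifs
        · simp only [h.round]
          linarith
        · linarith
    · simp only [if_neg h1]
      exact ⟨h.round, h.chain, fun C hC => (h.le C hC).trans hv⟩

theorem playRound_rewardBound {n q : ℕ} {w : ℕ → ℝ} (hw : ∀ m, 0 ≤ w m) (Z : Environment n)
    (A : Adversary n q) (coinsZ : Fin Z.coins → Bool) (coinsA : Fin A.coins → Bool)
    (ans : Fin n → Fin q → Bool) {m : ℕ} {v : ℝ} {st : State n}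
    (h : RewardBound w A.corrupted m v st) :
    RewardBound w A.corrupted (m + 1) (v + roundReward w A m ans)
      (playRound Z A coinsZ coinsA ans st) := by
  have key := foldl_add_invariant (turn Z A coinsZ coinsA ans)
    (fun i => if i ∈ A.corrupted then
      ∑ k : Fin q, if k.val < A.asks i ∧ ans i k = true then w m else 0 else 0)
    (RewardBound w A.corrupted m) (List.finRange n) ?_ v st h
  · rw [← Fin.sum_univ_def, ← Finset.sum_filter, Finset.filter_univ_mem] at key
    exact ⟨congrArg (· + 1) key.round, fun j => adopt_mem_valid _ _ _ (key.chain j), key.le⟩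
  · intro i _ v st h
    have h' : RewardBound w A.corrupted m v { st.log (.input i (Z.input coinsZ st i)) with
        input := Function.update st.input i (Z.input coinsZ st i) } :=
      ⟨h.round, h.chain, h.le⟩
    unfold turn
    dsimp only
    split_ifs with hi
    · exact corruptedTurn_rewardBound hw A coinsA h' (ans i)
    · rw [add_zero]
      exact honestTurn_rewardBound h' (ans i) hi

/-- The coalition earns at most the rewards of all the blocks that it finds. -/
theorem rewards_execution_le {n q : ℕ} (Z : Environment n) (A : Adversary n q)
    (W : RewardSchedule) (hw : ∀ m, 0 ≤ W.blockReward m) (ω : Randomness Z A) (j : Fin n) :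
    rewards W A.corrupted j (execution Z A ω) ≤
      ∑ m : Fin Z.rounds, roundReward W.blockReward A m fun i k => ω.1 (m, i, k) := by
  have key := foldl_finRange_add_invariant
    (fun st m => playRound Z A ω.2.1 ω.2.2 (fun i k => ω.1 (m, i, k)) st)
    (fun m => roundReward W.blockReward A m fun i k => ω.1 (m, i, k))
    (RewardBound W.blockReward A.corrupted)
    (fun m v st h => playRound_rewardBound hw Z A _ _ _ h) (State.init n)
    ⟨rfl, by simp [State.init], by simp [State.init, chainReward]⟩
  exact key.le _ (key.chain j)

/-! ### Costs -/

theorem queriesAsked_log {n : ℕ} (i : Fin n) (st : State n) (e : Event n) :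
    queriesAsked i (st.log e) = queriesAsked i st +
      match e with
      | .query i' _ _ _ _ => if i' = i then 1 else 0
      | _ => 0 := by
  cases e <;> simp [queriesAsked, State.log, List.countP_cons]

theorem queriesAsked_honestTurn {n q : ℕ} (ans : Fin q → Bool) {i i' : Fin n} (hi : i' ≠ i)
    (st : State n) : queriesAsked i (honestTurn ans i' st) = queriesAsked i st := by
  have key : queriesAsked i ((List.finRange q).foldl (fun st (k : Fin q) =>
      State.log st (.query i' k (st.chain i') (st.input i') (ans k))) st) = queriesAsked i st :=
    foldl_invariant _ (fun st' => queriesAsked i st' = queriesAsked i st) _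
      (fun k _ st' h => by rw [queriesAsked_log]; simpa [hi] using h) st rfl
  unfold honestTurn
  dsimp only
  split
  all_goals
    rw [← key]
    exact (queriesAsked_log i _ (.diffuse i' _)).trans (by simp)

theorem queriesAsked_corruptedTurn {n q : ℕ} (A : Adversary n q) (coins : Fin A.coins → Bool)
    (ans : Fin q → Bool) (i i' : Fin n) (st : State n) :
    queriesAsked i (corruptedTurn A coins ans i' st) =
      queriesAsked i st + if i' = i then A.asks i else 0 := by
  have hlen : (((List.finRange q).filter (fun k : Fin q => k.val < A.asks i')).map
      fun _ => if i' = i then 1 else 0).sum = if i' = i then A.asks i else 0 := by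
    split_ifs with h
    · subst h
      rw [sum_map_filter_finRange]
      simpa using card_filter_val_lt (A.asks_le i')
    · simp
  rw [← hlen]
  unfold corruptedTurn
  refine (queriesAsked_log i _ (.output i' _)).trans ?_
  refine foldl_add_invariant _ (fun _ => if i' = i then 1 else 0)
    (fun v st' => queriesAsked i st' = v) _ (fun k _ v st' h => ?_) _ st rfl
  rw [← h]
  exact queriesAsked_log i _ (.query i' k _ _ _)

theorem queriesAsked_playRound {n q : ℕ} (Z : Environment n) (A : Adversary n q)
    (coinsZ : Fin Z.coins → Bool) (coinsA : Fin A.coins → Bool) (ans : Fin n → Fin q → Bool)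
    {i : Fin n} (hi : i ∈ A.corrupted) (st : State n) :
    queriesAsked i (playRound Z A coinsZ coinsA ans st) = queriesAsked i st + A.asks i := by
  have key := foldl_add_invariant (turn Z A coinsZ coinsA ans)
    (fun i' => if i' = i then A.asks i else 0) (fun v st' => queriesAsked i st' = v)
    (List.finRange n) (fun i' _ v st' h => ?_) _ st rfl
  · rw [← Fin.sum_univ_def, Finset.sum_ite_eq' Finset.univ, if_pos (Finset.mem_univ _)] at key
    rw [← key]
    simp only [playRound, endRound, queriesAsked, List.countP_append, List.countP_map]
    simp [Function.comp_def]
  · have h0 : queriesAsked i { st'.log (.input i' (Z.input coinsZ st' i')) with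
        input := Function.update st'.input i' (Z.input coinsZ st' i') } = v :=
      (queriesAsked_log i st' (.input i' _)).trans h
    unfold turn
    dsimp only
    split_ifs with hi' hii hii
    · rw [queriesAsked_corruptedTurn, h0, if_pos hii]
    · rw [queriesAsked_corruptedTurn, h0, if_neg hii]
    · exact absurd (hii ▸ hi) hi'
    · rw [queriesAsked_honestTurn _ hii, h0, add_zero]

/-- This is where fixed cost enters: the count does not depend on `ω`, so only rewards need
concentration. -/
theorem queriesAsked_execution {n q : ℕ} (Z : Environment n) (A : Adversary n q)
    (ω : Randomness Z A) {i : Fin n} (hi : i ∈ A.corrupted) :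
    queriesAsked i (execution Z A ω) = Z.rounds * A.asks i := by
  have key := foldl_finRange_add_invariant
    (fun st m => playRound Z A ω.2.1 ω.2.2 (fun i k => ω.1 (m, i, k)) st)
    (fun _ => A.asks i) (fun _ v st => queriesAsked i st = v)
    (fun m v st h => by rw [queriesAsked_playRound Z A _ _ _ hi, h]) (State.init n) rfl
  rw [Fin.sum_const, smul_eq_mul] at key
  exact key

/-! ### Executions in which everybody follows the protocol -/

theorem length_le_adopt_self {n : ℕ} (valid : List (Chain n)) (C : Chain n) (L : List (Chain n)) :
    C.length ≤ (adopt valid C L).length := by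
  refine foldl_invariant _ (fun D : Chain n => C.length ≤ D.length) L (fun x _ st hst => ?_) C le_rfl
  split_ifs with hx
  · exact hst.trans hx.2.le
  · exact hst

theorem adopt_append {n : ℕ} (valid : List (Chain n)) (C : Chain n) (L L' : List (Chain n)) :
    adopt valid C (L ++ L') = adopt valid (adopt valid C L) L' :=
  List.foldl_append

theorem length_le_adopt {n : ℕ} (valid : List (Chain n)) (C : Chain n) {L : List (Chain n)}
    {D : Chain n} (hD : D ∈ L) (hv : D ∈ valid) : D.length ≤ (adopt valid C L).length := by
  obtain ⟨L₁, L₂, rfl⟩ := List.append_of_mem hD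
  rw [← List.singleton_append, adopt_append, adopt_append]
  refine le_trans ?_ (length_le_adopt_self _ _ _)
  simp only [adopt, List.foldl_cons, List.foldl_nil]
  split_ifs with h
  · exact le_rfl
  · simp only [hv, true_and, not_lt] at h
    exact h

theorem adopt_eq_self {n : ℕ} (valid : List (Chain n)) (C : Chain n) {L : List (Chain n)}
    (h : ∀ D ∈ L, D.length ≤ C.length) : adopt valid C L = C :=
  foldl_invariant _ (· = C) L
    (fun x hx st hst => by rw [if_neg]; exacts [hst, fun h' => by have := h x hx; grind]) C rfl

theorem adopt_mem {n : ℕ} (valid : List (Chain n)) (C : Chain n) (P : Chain n → Prop)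
    {L : List (Chain n)} (hC : P C) (h : ∀ D ∈ L, P D) : P (adopt valid C L) := by
  refine foldl_invariant _ P L (fun x hx st hst => ?_) C hC
  split_ifs
  · exact h x hx
  · exact hst

/-- In round `m`, in which all participants have the local chain `C`, the participants in `F` have
found blocks. -/
structure AgreeOn {n : ℕ} (C : Chain n) (m : ℕ) (F : Multiset (Fin n)) (st : State n) : Prop where
  round : st.round = m
  chain : ∀ j, st.chain j = C
  mem : C ∈ st.valid
  valid : ∀ D ∈ st.valid, (∀ b ∈ D.head?, b.round < m) ∨ ∃ b, b.round = m ∧ D = b :: C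
  pending : ∀ D ∈ st.pending, D = C ∨ ∃ b, b.round = m ∧ D = b :: C
  found : ∀ i ∈ F, ∃ b, b.round = m ∧ b.producer = i ∧ b :: C ∈ st.valid

theorem AgreeOn.honestTurn {n q : ℕ} {C : Chain n} {m : ℕ} {F : Multiset (Fin n)} {st : State n}
    (h : AgreeOn C m F st) (ans : Fin q → Bool) (i : Fin n) :
    AgreeOn C m F (honestTurn ans i st) := by
  obtain ⟨t, ht⟩ := foldl_log (fun (st : State n) (k : Fin q) =>
    Event.query i k (st.chain i) (st.input i) (ans k)) (List.finRange q) st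
  unfold BitcoinEVP.honestTurn
  simp only [ht]
  split
  · refine ⟨h.round, h.chain, h.mem, h.valid, fun D hD => ?_, h.found⟩
    rcases List.mem_append.1 hD with hD | hD
    · exact h.pending D hD
    · exact .inl ((List.mem_singleton.1 hD).trans (h.chain i))
  · refine ⟨h.round, h.chain, List.mem_append_left _ h.mem, fun D hD => ?_, fun D hD => ?_,
      fun i hi => ?_⟩
    · rcases List.mem_append.1 hD with hD | hD
      · exact h.valid D hD
      · exact .inr ⟨_, h.round, (List.mem_singleton.1 hD).trans (by rw [h.chain])⟩
    · rcases List.mem_append.1 hD with hD | hD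
      · exact h.pending D hD
      · exact .inr ⟨_, h.round, (List.mem_singleton.1 hD).trans (by rw [h.chain])⟩
    · obtain ⟨b, hb, hbi, hbv⟩ := h.found i hi
      exact ⟨b, hb, hbi, List.mem_append_left _ hbv⟩

/-- The finders form a multiset so that each successful query contributes `{i}` to an additive
monoid; only membership is used afterwards. -/
theorem AgreeOn.corruptedTurn {n q : ℕ} {T : Finset (Fin n)} {C : Chain n} {m : ℕ}
    {F : Multiset (Fin n)} {st : State n} (h : AgreeOn C m F st)
    (coins : Fin (followProtocol q T).coins → Bool) (ans : Fin q → Bool) (i : Fin n) :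
    AgreeOn C m (F + ∑ k, if ans k = true then {i} else 0)
      (corruptedTurn (followProtocol q T) coins ans i st) := by
  have hsum : (∑ k, if ans k = true then {i} else (0 : Multiset (Fin n))) =
      (((List.finRange q).filter
        (fun k : Fin q => k.val < (followProtocol q T).asks i)).map fun k =>
        if ans k = true then {i} else 0).sum := by
    rw [sum_map_filter_finRange]
    simp [followProtocol]
  rw [hsum]
  have key := foldl_add_invariant
    (fun (st : State n) (k : Fin q) =>
      let a := (followProtocol q T).query coins st i k
      { st.log (.query i k a.1 a.2 (ans k)) with
        valid := if ans k = true ∧ a.1 ∈ st.valid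
          then st.valid ++ [⟨st.round, i, k, a.2⟩ :: a.1] else st.valid })
    (fun k => if ans k = true then {i} else 0) (AgreeOn C m)
    ((List.finRange q).filter (fun k : Fin q => k.val < (followProtocol q T).asks i)) ?_ F st h
  · exact ⟨key.round, key.chain, key.mem, key.valid, key.pending, key.found⟩
  · intro k _ F st h
    have hq : ((followProtocol q T).query coins st i k).1 = C := h.chain i
    by_cases hk : ans k = true
    · simp only [hk, hq, h.mem, and_self, if_true]
      refine ⟨h.round, h.chain, List.mem_append_left _ h.mem, fun D hD => ?_, h.pending,
        fun j hj => ?_⟩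
      · rcases List.mem_append.1 hD with hD | hD
        · exact h.valid D hD
        · exact .inr ⟨_, h.round, List.mem_singleton.1 hD⟩
      · rcases Multiset.mem_add.1 hj with hj | hj
        · obtain ⟨b, hb, hbi, hbv⟩ := h.found j hj
          exact ⟨b, hb, hbi, List.mem_append_left _ hbv⟩
        · exact ⟨_, h.round, (Multiset.mem_singleton.1 hj).symm,
            List.mem_append_right _ (List.mem_singleton_self _)⟩
    · simp only [if_neg hk, add_zero, if_neg fun h : ans k = true ∧ _ => hk h.1]
      exact ⟨h.round, h.chain, h.mem, h.valid, h.pending, h.found⟩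

/-- At the beginning of round `m`, all participants have the same chain, in which the members of `T`
have earned at least `v`. -/
def Synchronized {n : ℕ} (w : ℕ → ℝ) (T : Finset (Fin n)) (m : ℕ) (v : ℝ) (st : State n) : Prop :=
  ∃ C : Chain n, st.round = m ∧ (∀ j, st.chain j = C) ∧ C ∈ st.valid ∧
    (∀ D ∈ st.valid, ∀ b ∈ D.head?, b.round < m) ∧ st.pending = [] ∧ v ≤ chainReward w T C

open Classical in
-- All chains in circulation are the common chain `C` or extend it by one block. The first extension
-- received is therefore final, and the coalition's messages `L`, the same for everyone, come first.
theorem AgreeOn.endRound {n q : ℕ} {w : ℕ → ℝ} (hw : ∀ m, 0 ≤ w m) {T : Finset (Fin n)}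
    {C : Chain n} {m : ℕ} {F : Multiset (Fin n)} {st : State n} (h : AgreeOn C m F st)
    (coins : Fin (followProtocol q T).coins → Bool) {v : ℝ} (hv : v ≤ chainReward w T C) :
    Synchronized w T (m + 1) (v + if ∃ i ∈ T, i ∈ F then w m else 0)
      (endRound (followProtocol q T) coins st) := by
  let f : Fin n → Chain n := fun i => (st.valid.find? fun C =>
    C.head?.any fun b => decide (b.producer = i ∧ b.round = st.round)).getD (st.chain i)
  let L := ((List.finRange n).filter (· ∈ T)).map f
  have hf : ∀ i, f i = C ∨ ∃ b, b.round = m ∧ b.producer = i ∧ f i = b :: C := by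
    intro i
    rcases hfi : (st.valid.find? fun C =>
      C.head?.any fun b => decide (b.producer = i ∧ b.round = st.round)) with _ | D
    · exact .inl (by simp only [f, hfi, Option.getD_none, h.chain])
    -- The chain found has a head of round `m`, which excludes old valid chains and leaves only
    -- one-block extensions of `C`.
    · have hD := h.valid D (List.mem_of_find?_eq_some hfi)
      have hp := List.find?_some hfi
      simp only [Option.any_eq_true, decide_eq_true_eq, h.round] at hp
      obtain ⟨b, hb, hbi, hbm⟩ := hp
      rcases hD with hD | ⟨b', -, rfl⟩
      · exact absurd hbm (hD b hb).ne
      · simp only [List.head?_cons, Option.some.injEq] at hb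
        subst hb
        exact .inr ⟨b', hbm, hbi, by simp only [f, hfi, Option.getD_some]⟩
  have hL : ∀ D ∈ L, D = C ∨ ∃ b, b.round = m ∧ b.producer ∈ T ∧ D = b :: C := by
    intro D hD
    obtain ⟨i, hi, rfl⟩ := List.mem_map.1 hD
    have hiT : i ∈ T := by simpa using (List.mem_filter.1 hi).2
    rcases hf i with hi | ⟨b, hb, hbi, hfi⟩
    · exact .inl hi
    · exact .inr ⟨b, hb, hbi ▸ hiT, hfi⟩
  have hE := adopt_mem st.valid C (fun D => D = C ∨ ∃ b, b.round = m ∧ b.producer ∈ T ∧ D = b :: C)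
    (.inl rfl) hL
  set E := adopt st.valid C L with hEdef
  set G := adopt st.valid C (L ++ st.pending) with hG
  have hGE : G = adopt st.valid E st.pending := adopt_append _ _ _ _
  refine ⟨G, congrArg (· + 1) h.round, fun j => ?_, adopt_mem_valid _ _ _ h.mem, ?_, rfl, ?_⟩
  · change adopt st.valid (st.chain j) (L ++ st.pending) = G
    rw [h.chain]
  · intro D hD b hb
    rcases h.valid D hD with hD | ⟨b', hb', rfl⟩
    · exact (hD b hb).trans (Nat.lt_succ_self m)
    · simp only [List.head?_cons, Option.mem_def, Option.some.injEq] at hb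
      subst hb
      omega
  -- `E` is the chain after the adversary's deliveries. If it is still `C`, no member of `T` found a
  -- block, since its message would have been strictly longer. If it is `b :: C`, no pending chain
  -- can replace it.
  · rcases hE with hE | ⟨b, hbm, hbT, hE⟩
    · rw [if_neg, add_zero]
      · have := adopt_mem st.valid E (fun D => D = C ∨ ∃ b, b.round = m ∧ D = b :: C)
          (.inl hE) h.pending
        rw [← hGE] at this
        rcases this with hg | ⟨b, -, hg⟩
        · rwa [hg]
        · rw [hg, chainReward_cons]
          have := hw b.round
          split_ifs <;> linarith
      · rintro ⟨i, hiT, hiF⟩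
        obtain ⟨b, hb, hbi, hbv⟩ := h.found i hiF
        have hmem : f i ∈ L := List.mem_map_of_mem (by simp [hiT])
        have hsome : (st.valid.find? fun C =>
            C.head?.any fun b => decide (b.producer = i ∧ b.round = st.round)).isSome := by
          rw [List.find?_isSome]
          exact ⟨_, hbv, by simp [hbi, hb, h.round]⟩
        obtain ⟨D, hD⟩ := Option.isSome_iff_exists.1 hsome
        have hfD : f i = D := by simp only [f, hD, Option.getD_some]
        have hDv := List.mem_of_find?_eq_some hD
        have hlen := length_le_adopt st.valid C hmem (hfD ▸ hDv)
        rw [← hEdef, hE] at hlen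
        rcases hf i with hfi | ⟨b', -, -, hfi⟩
        · have hp := List.find?_some hD
          rw [← hfD, hfi] at hp
          simp only [Option.any_eq_true, decide_eq_true_eq, h.round] at hp
          obtain ⟨b', hb', -, hbm'⟩ := hp
          rcases h.valid C h.mem with hC | ⟨b'', -, hC⟩
          · exact absurd hbm' (hC b' hb').ne
          · exact absurd (congrArg List.length hC) (by simp)
        · rw [hfi] at hlen
          simp at hlen
    · have : G = b :: C := by
        rw [hGE, hE]
        refine adopt_eq_self _ _ fun D hD => ?_
        rcases h.pending D hD with rfl | ⟨b', -, rfl⟩ <;> simp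
      rw [this, chainReward_cons, if_pos hbT, hbm]
      have := hw m
      split_ifs <;> linarith

open Classical in
theorem playRound_synchronized {n q : ℕ} {w : ℕ → ℝ} (hw : ∀ m, 0 ≤ w m) (Z : Environment n)
    (T : Finset (Fin n)) (coinsZ : Fin Z.coins → Bool)
    (coinsA : Fin (followProtocol q T).coins → Bool) (ans : Fin n → Fin q → Bool) {m : ℕ} {v : ℝ}
    {st : State n} (h : Synchronized w T m v st) :
    Synchronized w T (m + 1) (v + if ∃ i ∈ T, ∃ k, ans i k = true then w m else 0)
      (playRound Z (followProtocol q T) coinsZ coinsA ans st) := by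
  obtain ⟨C, hr, hc, hC, hD, hp, hv⟩ := h
  have h0 : AgreeOn C m 0 st := ⟨hr, hc, hC, fun D h => .inl (hD D h), by simp [hp], by simp⟩
  have key := foldl_add_invariant (turn Z (followProtocol q T) coinsZ coinsA ans)
    (fun i => if i ∈ T then ∑ k, if ans i k = true then {i} else 0 else 0)
    (AgreeOn C m) (List.finRange n) ?_ 0 st h0
  · rw [← Fin.sum_univ_def, zero_add] at key
    have hiff : (∃ i ∈ T, ∃ k, ans i k = true) ↔ ∃ i ∈ T, i ∈ ∑ i, if i ∈ T then
        ∑ k, if ans i k = true then {i} else (0 : Multiset (Fin n)) else 0 := by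
      refine exists_congr fun i => and_congr_right fun hi => ?_
      rw [Multiset.mem_sum]
      constructor
      · rintro ⟨k, hk⟩
        refine ⟨i, Finset.mem_univ _, ?_⟩
        rw [if_pos hi, Multiset.mem_sum]
        exact ⟨k, Finset.mem_univ _, by simp [hk]⟩
      · rintro ⟨i', -, hi'⟩
        split_ifs at hi'
        · obtain ⟨k, -, hk⟩ := Multiset.mem_sum.1 hi'
          split_ifs at hk with hk'
          · rw [Multiset.mem_singleton] at hk
            exact ⟨k, hk ▸ hk'⟩
          · simp at hk
        · simp at hi'
    simp only [hiff]
    exact AgreeOn.endRound hw key coinsA hv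
  · intro i _ F st h
    have h' : AgreeOn C m F { st.log (.input i (Z.input coinsZ st i)) with
        input := Function.update st.input i (Z.input coinsZ st i) } :=
      ⟨h.round, h.chain, h.mem, h.valid, h.pending, h.found⟩
    unfold turn
    dsimp only
    by_cases hi : i ∈ T
    · rw [if_pos hi]
      exact (if_pos (c := i ∈ (followProtocol q T).corrupted) hi) ▸ h'.corruptedTurn coinsA (ans i) i
    · rw [if_neg hi, add_zero]
      exact (if_neg (c := i ∈ (followProtocol q T).corrupted) hi) ▸ h'.honestTurn (ans i) i

open Classical in
/-- If everybody follows the protocol and the coalition delivers first, it earns the block reward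
of every round in which it finds a block. -/
theorem le_rewards_execution_followProtocol {n q : ℕ} (Z : Environment n) (T : Finset (Fin n))
    (W : RewardSchedule) (hw : ∀ m, 0 ≤ W.blockReward m) (ω : Randomness Z (followProtocol q T))
    (j : Fin n) :
    (∑ m : Fin Z.rounds, if ∃ i ∈ T, ∃ k, ω.1 (m, i, k) = true then W.blockReward m else 0) ≤
      rewards W T j (execution Z (followProtocol q T) ω) := by
  obtain ⟨C, -, hc, -, -, -, hv⟩ := foldl_finRange_add_invariant
    (fun st m => playRound Z (followProtocol q T) ω.2.1 ω.2.2 (fun i k => ω.1 (m, i, k)) st)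
    (fun m : Fin Z.rounds =>
      if ∃ i ∈ T, ∃ k, ω.1 (m, i, k) = true then W.blockReward m else 0)
    (Synchronized W.blockReward T)
    (fun m v st h => playRound_synchronized hw Z T _ _ _ h) (State.init n)
    ⟨[], rfl, fun _ => rfl, by simp [State.init], by simp [State.init], rfl, le_rfl⟩
  refine hv.trans_eq ?_
  rw [← hc j]
  rfl

/-! ### Concentration -/

/-- Hoeffding's inequality: variables in `[0, 1]` are sub-Gaussian with parameter `1 / 4` after
centring. -/
theorem measure_sum_gt_le {Ω ι : Type*} [MeasurableSpace Ω] {μ : Measure Ω}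
    [IsProbabilityMeasure μ] {X : ι → Ω → ℝ} (hX : ∀ i, Measurable (X i))
    (hind : ProbabilityTheory.iIndepFun X μ) (hb : ∀ i ω, X i ω ∈ Set.Icc (0 : ℝ) 1)
    (K : Finset ι) {a η : ℝ} (hη : 0 ≤ η) (ha : ∀ i, (∫ ω, X i ω ∂μ) ≤ a) :
    μ.real {ω | K.card * (a + η) < ∑ i ∈ K, X i ω} ≤ Real.exp (-(2 * η ^ 2 * K.card)) := by
  have hsub : ∀ i ∈ K, ProbabilityTheory.HasSubgaussianMGF (fun ω => X i ω - (∫ ω, X i ω ∂μ))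
      ((‖(1 : ℝ) - 0‖₊ / 2) ^ 2) μ := fun i _ =>
    ProbabilityTheory.hasSubgaussianMGF_of_mem_Icc (hX i).aemeasurable (.of_forall (hb i))
  have hind' : ProbabilityTheory.iIndepFun (fun i ω => X i ω - (∫ ω, X i ω ∂μ)) μ :=
    hind.comp (fun i x => x - (∫ ω, X i ω ∂μ)) fun i => measurable_id.sub_const _
  have key := ProbabilityTheory.HasSubgaussianMGF.measure_sum_ge_le_of_iIndepFun hind' hsub
    (ε := K.card * η) (by positivity)
  refine (measureReal_mono fun ω hω => ?_).trans (key.trans_eq ?_)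
  · simp only [Set.mem_ofPred_eq, Finset.sum_sub_distrib] at hω ⊢
    have : ∑ i ∈ K, (∫ ω, X i ω ∂μ) ≤ K.card * a := by
      simpa using Finset.sum_le_sum fun i (_ : i ∈ K) => ha i
    linarith
  · congr 1
    simp only [sub_zero, nnnorm_one, Finset.sum_const, nsmul_eq_mul]
    -- The exponent is `-(|K| η) ^ 2 / (2 |K| / 4)`; cancelling `|K|` requires `K` to be nonempty.
    rcases K.eq_empty_or_nonempty with rfl | hK
    · simp
    · have : (K.card : ℝ) ≠ 0 := by exact_mod_cast hK.card_pos.ne'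
      push_cast
      field_simp

/-- The upper tail applied to `1 - X i`. -/
theorem measure_sum_lt_le {Ω ι : Type*} [MeasurableSpace Ω] {μ : Measure Ω}
    [IsProbabilityMeasure μ] {X : ι → Ω → ℝ} (hX : ∀ i, Measurable (X i))
    (hind : ProbabilityTheory.iIndepFun X μ) (hb : ∀ i ω, X i ω ∈ Set.Icc (0 : ℝ) 1)
    (K : Finset ι) {a η : ℝ} (hη : 0 ≤ η) (ha : ∀ i, a ≤ (∫ ω, X i ω ∂μ)) :
    μ.real {ω | ∑ i ∈ K, X i ω < K.card * (a - η)} ≤ Real.exp (-(2 * η ^ 2 * K.card)) := by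
  have key := measure_sum_gt_le (X := fun i ω => 1 - X i ω) (μ := μ) (a := 1 - a)
    (fun i => measurable_const.sub (hX i))
    (hind.comp (fun _ x => 1 - x) fun _ => measurable_const.sub measurable_id)
    (fun i ω => ⟨by linarith [(hb i ω).2], by linarith [(hb i ω).1]⟩) K hη (fun i => ?_)
  · refine (measureReal_mono fun ω hω => ?_).trans key
    simp only [Set.mem_ofPred_eq, Finset.sum_sub_distrib, Finset.sum_const, nsmul_eq_mul] at hω ⊢
    linarith
  · have h := ha i
    rw [integral_sub (integrable_const _)
      (Integrable.of_mem_Icc 0 1 (hX i).aemeasurable (.of_forall (hb i)))]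
    simp only [integral_const, probReal_univ, smul_eq_mul, one_mul]
    linarith

/-- The law of the answers of the random oracle. -/
noncomputable def oracleLaw (ι : Type*) [Fintype ι] (p : unitInterval) : Measure (ι → Bool) :=
  Measure.pi fun _ => ProbabilityTheory.bernoulliMeasure true false p

instance (ι : Type*) [Fintype ι] (p : unitInterval) : IsProbabilityMeasure (oracleLaw ι p) := by
  unfold oracleLaw
  infer_instance

theorem iIndepFun_oracleLaw (ι : Type*) [Fintype ι] (p : unitInterval) :
    ProbabilityTheory.iIndepFun (fun i (ω : ι → Bool) => if ω i = true then (1 : ℝ) else 0)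
      (oracleLaw ι p) :=
  ProbabilityTheory.iIndepFun_pi (X := fun _ b => if b = true then (1 : ℝ) else 0)
    fun _ => (measurable_of_countable _).aemeasurable

theorem oracleLaw_forall_false {ι : Type*} [Fintype ι] (p : unitInterval) (K : Finset ι) :
    oracleLaw ι p {ω | ∀ a ∈ K, ω a = false} = ENNReal.ofReal (1 - p) ^ K.card := by
  classical
  have : {ω : ι → Bool | ∀ a ∈ K, ω a = false} =
      Set.univ.pi fun a => if a ∈ K then {false} else Set.univ := by
    ext ω
    simp only [Set.mem_ofPred_eq, Set.mem_pi, Set.mem_univ, true_imp_iff]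
    refine forall_congr' fun a => ?_
    split_ifs with h <;> simp [h]
  rw [this, oracleLaw, Measure.pi_pi]
  have h1 : ProbabilityTheory.bernoulliMeasure true false p {false} = ENNReal.ofReal (1 - p) := by
    rw [ProbabilityTheory.bernoulliMeasure_apply_of_notMem_of_mem _ (by measurability) (by simp)
      (by simp), ENNReal.ofReal]
    congr 1
    ext
    simp [Real.coe_toNNReal _ (sub_nonneg.2 p.2.2)]
  calc _ = ∏ a, if a ∈ K then ENNReal.ofReal (1 - p) else 1 := by
        refine Finset.prod_congr rfl fun a _ => ?_
        split_ifs
        · exact h1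
        · simp
    _ = _ := by rw [Finset.prod_ite_mem, Finset.univ_inter, Finset.prod_const]

theorem integral_oracleLaw (ι : Type*) [Fintype ι] (p : unitInterval) (i : ι) :
    ∫ ω, (if ω i = true then (1 : ℝ) else 0) ∂oracleLaw ι p = p := by
  have h := ProbabilityTheory.integral_bernoulliMeasure true false p
    fun b => if b = true then (1 : ℝ) else 0
  rw [← (measurePreserving_eval
    (fun _ : ι => ProbabilityTheory.bernoulliMeasure true false p) i).map_eq,
    integral_map (measurable_pi_apply i).aemeasurable
      (measurable_of_countable _).aestronglyMeasurable] at h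
  simpa [oracleLaw] using h

/-- Among the queries in `K`, there are rarely many more successful ones than expected. -/
theorem oracleLaw_sum_gt_le {ι : Type*} [Fintype ι] (p : unitInterval) (K : Finset ι) {δ : ℝ}
    (hδ : 0 ≤ δ) :
    (oracleLaw ι p).real {ω | (1 + δ) * p * K.card < ∑ a ∈ K, if ω a = true then (1 : ℝ) else 0} ≤
      Real.exp (-(2 * (δ * p) ^ 2 * K.card)) := by
  have := p.2.1
  refine le_trans (measureReal_mono ?_) (measure_sum_gt_le (a := p) (η := δ * p)
    (fun i => measurable_of_countable _) (iIndepFun_oracleLaw ι p) ?_ K (by positivity)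
    fun i => (integral_oracleLaw ι p i).le)
  · intro ω hω
    simp only [Set.mem_ofPred_eq] at hω ⊢
    linarith
  · intro i ω
    split_ifs <;> simp

open Classical in
/-- If in each round the queries in `S` are asked, there are rarely much fewer rounds in `K` with a
successful query than expected. -/
theorem oracleLaw_sum_exists_lt_le {ρ κ : Type*} [Fintype ρ] [Fintype κ] (p : unitInterval)
    (S : Finset κ) (K : Finset ρ) {a η : ℝ} (hη : 0 ≤ η)
    (ha : a ≤ 1 - (1 - (p : ℝ)) ^ S.card) :
    (oracleLaw (ρ × κ) p).real
      {ω | (∑ m ∈ K, if ∃ x ∈ S, ω (m, x) = true then (1 : ℝ) else 0) < K.card * (a - η)} ≤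
      Real.exp (-(2 * η ^ 2 * K.card)) := by
  set μ := oracleLaw (ρ × κ) p with hμ
  let f : ρ → Set (ρ × κ → Bool) := fun m => {ω | ∃ x ∈ S, ω (m, x) = true}
  have hfm : ∀ m, MeasurableSet (f m) := fun m => Set.to_countable _ |>.measurableSet
  -- Independence of the rounds is checked on the complementary events of no success: their
  -- intersections are cylinders with explicit probability.
  have hcap : ∀ s : Finset ρ, μ (⋂ m ∈ s, (f m)ᶜ) = ENNReal.ofReal (1 - p) ^ (s.card * S.card) := by
    intro s
    rw [← Finset.card_product, ← oracleLaw_forall_false p (s ×ˢ S)]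
    congr 1
    ext ω
    simp only [f, Set.mem_iInter, Set.mem_compl_iff, Set.mem_ofPred_eq, not_exists, not_and,
      Bool.not_eq_true, Finset.mem_product, Prod.forall, and_imp]
    exact ⟨fun h a b ha hb => h a ha b hb, fun h a ha b hb => h a b ha hb⟩
  have hone : ∀ m, μ (f m)ᶜ = ENNReal.ofReal (1 - p) ^ S.card := fun m => by
    simpa using hcap {m}
  have hset : ProbabilityTheory.iIndepSet (fun m => (f m)ᶜ) μ := by
    rw [ProbabilityTheory.iIndepSet_iff_meas_biInter fun m => (hfm m).compl]
    intro s
    rw [hcap, Finset.prod_congr rfl fun m _ => hone m, Finset.prod_const, ← pow_mul, mul_comm]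
  have hind : ProbabilityTheory.iIndepFun
      (fun m ω => if ∃ x ∈ S, ω (m, x) = true then (1 : ℝ) else 0) μ := by
    have h := (hset.iIndepFun_indicator (β := ℝ)).comp (fun _ x => 1 - x)
      fun _ => measurable_const.sub measurable_id
    convert h using 3 with m ω
    by_cases h : ∃ x ∈ S, ω (m, x) = true <;> simp [f, h]
  refine measure_sum_lt_le (fun i => measurable_of_countable _) hind ?_ K hη fun m => ?_
  · intro i ω
    split_ifs <;> simp
  · have hind : (fun ω => if ∃ x ∈ S, ω (m, x) = true then (1 : ℝ) else 0) =
        (f m).indicator 1 := by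
      ext ω
      by_cases h : ∃ x ∈ S, ω (m, x) = true <;> simp [f, h]
    rw [hind, integral_indicator_one (hfm m), ← compl_compl (f m),
      probReal_compl_eq_one_sub (hfm m).compl, Measure.real, hone,
      ENNReal.toReal_pow, ENNReal.toReal_ofReal (sub_nonneg.2 p.2.2)]
    exact ha

/-- By Bernoulli's inequality, `(1 - p) ^ N * (1 + p * N) ≤ (1 - p) ^ N * (1 + p) ^ N = (1 - p ^ 2)
^ N ≤ 1`. -/
theorem le_one_sub_one_sub_pow {p : ℝ} (hp : p ∈ Set.Icc (0 : ℝ) 1) (N : ℕ) :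
    p * N / (1 + p * N) ≤ 1 - (1 - p) ^ N := by
  have h1 : (1 - p) ^ N * (1 + p * N) ≤ 1 := by
    have hb : 1 + p * N ≤ (1 + p) ^ N := by
      have := one_add_mul_le_pow (a := p) (by linarith [hp.1]) N
      linarith
    calc (1 - p) ^ N * (1 + p * N) ≤ (1 - p) ^ N * (1 + p) ^ N :=
          mul_le_mul_of_nonneg_left hb (pow_nonneg (by linarith [hp.2]) N)
      _ = (1 - p ^ 2) ^ N := by rw [← mul_pow]; ring_nf
      _ ≤ 1 := pow_le_one₀ (by nlinarith [hp.1, hp.2]) (by nlinarith [hp.1])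
  have := hp.1
  have h2 : 0 < 1 + p * N := by positivity
  rw [div_le_iff₀ h2]
  linarith

/-! ### Reward schedules -/

/-- The number of changes of the block reward up to round `i`. -/
def RewardSchedule.index (W : RewardSchedule) (i : ℕ) : ℕ :=
  ((Finset.Icc 1 W.changes).filter fun j => W.start j ≤ i).card

theorem RewardSchedule.index_le (W : RewardSchedule) (i : ℕ) : W.index i ≤ W.changes :=
  (Finset.card_filter_le _ _).trans (by simp)

/-- The rounds of an execution of `R` rounds in which `W.reward j` is in force. -/
def RewardSchedule.segment (W : RewardSchedule) (R j : ℕ) : Finset (Fin R) :=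
  Finset.univ.filter fun m => W.index m = j

theorem RewardSchedule.sum_segment (W : RewardSchedule) (R : ℕ) (f : Fin R → ℝ) :
    ∑ m, f m = ∑ j ∈ Finset.range (W.changes + 1), ∑ m ∈ W.segment R j, f m :=
  (Finset.sum_fiberwise_of_maps_to (s := Finset.univ) (g := fun m : Fin R => W.index m)
    (fun m _ => Finset.mem_range.2 (Nat.lt_succ_of_le (W.index_le m))) f).symm

theorem RewardSchedule.blockReward_of_mem_segment (W : RewardSchedule) {R j : ℕ} {m : Fin R}
    (h : m ∈ W.segment R j) : W.blockReward m = W.reward j :=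
  congrArg W.reward (Finset.mem_filter.1 h).2

namespace RewardSchedule.ChangesEvery

variable {W : RewardSchedule} {L : ℝ} {R : ℕ}

/-- Change rounds are integers and strictly increase because `L > 0`. This also bounds the number of
changes by the number of rounds, which the union bound needs. -/
theorem start_add_le (h : W.ChangesEvery L R) (hL : 0 < L) {i j : ℕ} (hij : i ≤ j)
    (hj : j ≤ W.changes) : W.start i + (j - i) ≤ W.start j := by
  induction j, hij using Nat.le_induction with
  | base => simp
  | succ j hij ih =>
    have h1 := ih (by omega)
    have h2 : W.start j < W.start (j + 1) := by
      have := h.between j (by omega)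
      exact_mod_cast (lt_add_of_pos_right (W.start j : ℝ) hL).trans_le this
    omega

theorem changes_le (h : W.ChangesEvery L R) (hL : 0 < L) : W.changes ≤ R := by
  have h1 := h.start_add_le hL (Nat.zero_le _) le_rfl
  have h2 : W.start W.changes ≤ R := by
    exact_mod_cast (le_add_of_nonneg_right hL.le).trans h.after_last
  omega

theorem index_eq (h : W.ChangesEvery L R) (hL : 0 < L) {i j : ℕ} (hj : j ≤ W.changes)
    (hi : W.start j ≤ i) (hi' : j < W.changes → i < W.start (j + 1)) : W.index i = j := by
  have : (Finset.Icc 1 W.changes).filter (fun k => W.start k ≤ i) = Finset.Icc 1 j := by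
    ext k
    simp only [Finset.mem_filter, Finset.mem_Icc]
    constructor
    · rintro ⟨⟨h1, h2⟩, h3⟩
      refine ⟨h1, ?_⟩
      by_contra! hlt
      have := h.start_add_le hL (i := j + 1) hlt h2
      have := hi' (by omega)
      omega
    · rintro ⟨h1, h2⟩
      have := h.start_add_le hL h2 hj
      exact ⟨⟨h1, by omega⟩, by omega⟩
  rw [RewardSchedule.index, this, Nat.card_Icc, Nat.add_sub_cancel]

/-- The segment contains every round from `start j` up to the next change, or up to the end of the
execution if there is none. -/
theorem le_card_segment (h : W.ChangesEvery L R) (hL : 0 < L) {j : ℕ} (hj : j ≤ W.changes) :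
    L ≤ (W.segment R j).card := by
  obtain ⟨b, hbR, hLb, hb⟩ : ∃ b ≤ R, (W.start j : ℝ) + L ≤ b ∧
      ∀ i, W.start j ≤ i → i < b → W.index i = j := by
    have hlast : W.start W.changes ≤ R := by
      exact_mod_cast (le_add_of_nonneg_right hL.le).trans h.after_last
    rcases hj.lt_or_eq with hlt | rfl
    · refine ⟨W.start (j + 1), ?_, h.between j hlt, fun i h1 h2 => h.index_eq hL hj h1 fun _ => h2⟩
      have := h.start_add_le hL (i := j + 1) hlt le_rfl
      omega
    · exact ⟨R, le_rfl, h.after_last, fun i h1 _ => h.index_eq hL le_rfl h1 fun h => by omega⟩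
  have hcard : (Finset.Ico (W.start j) b).card ≤ (W.segment R j).card := by
    rw [← Finset.card_map Fin.valEmbedding (s := W.segment R j)]
    refine Finset.card_le_card fun i hi => ?_
    rw [Finset.mem_Ico] at hi
    rw [Finset.mem_map]
    exact ⟨⟨i, hi.2.trans_le hbR⟩, Finset.mem_filter.2 ⟨Finset.mem_univ _, hb i hi.1 hi.2⟩, rfl⟩
  rw [Nat.card_Ico] at hcard
  have : (b : ℝ) ≤ (W.start j : ℝ) + (W.segment R j).card := by
    exact_mod_cast (by omega : b ≤ W.start j + (W.segment R j).card)
  linarith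

end RewardSchedule.ChangesEvery

/-! ### Bounds for the utility -/

/-- The queries that the coalition of `A` asks in each round. -/
def Adversary.queries {n q : ℕ} (A : Adversary n q) : Finset (Fin n × Fin q) :=
  Finset.univ.filter fun x => x.1 ∈ A.corrupted ∧ x.2.val < A.asks x.1

theorem Adversary.sum_queries {n q : ℕ} {M : Type*} [AddCommMonoid M] (A : Adversary n q)
    (f : Fin n × Fin q → M) :
    ∑ x ∈ A.queries, f x = ∑ i ∈ A.corrupted, ∑ k : Fin q, if k.val < A.asks i then f (i, k) else 0 := by
  rw [Adversary.queries, Finset.sum_filter, Fintype.sum_prod_type]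
  simp only [ite_and]
  rw [← Finset.sum_filter_add_sum_filter_not Finset.univ (· ∈ A.corrupted)]
  simp only [Finset.filter_univ_mem]
  rw [Finset.sum_eq_zero (s := Finset.univ.filter (· ∉ A.corrupted)), add_zero]
  · exact Finset.sum_congr rfl fun i hi => by simp [hi]
  · intro i hi
    simp [(Finset.mem_filter.1 hi).2]

theorem Adversary.card_queries {n q : ℕ} (A : Adversary n q) :
    A.queries.card = ∑ i ∈ A.corrupted, A.asks i := by
  rw [Finset.card_eq_sum_ones, A.sum_queries]
  exact Finset.sum_congr rfl fun i _ => card_filter_val_lt (A.asks_le i)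

theorem Adversary.card_queries_le {n q : ℕ} (A : Adversary n q) :
    A.queries.card ≤ A.corrupted.card * q := by
  rw [A.card_queries, ← smul_eq_mul]
  exact Finset.sum_le_card_nsmul _ _ _ fun i _ => A.asks_le i

theorem card_queries_followProtocol {n : ℕ} (q : ℕ) (T : Finset (Fin n)) :
    (followProtocol q T).queries.card = T.card * q := by
  rw [Adversary.card_queries]
  simp [followProtocol]

theorem roundReward_eq {n q : ℕ} (w : ℕ → ℝ) (A : Adversary n q) (m : ℕ)
    (ans : Fin n → Fin q → Bool) :
    roundReward w A m ans =
      w m * ∑ x ∈ A.queries, if ans x.1 x.2 = true then (1 : ℝ) else 0 := by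
  rw [A.sum_queries, Finset.mul_sum, roundReward]
  refine Finset.sum_congr rfl fun i _ => ?_
  rw [Finset.mul_sum]
  exact Finset.sum_congr rfl fun k _ => by simp only [ite_and, mul_ite, mul_one, mul_zero]

theorem sum_cost_execution {n q : ℕ} (Z : Environment n) (A : Adversary n q)
    (ω : Randomness Z A) (c : ℝ) :
    ∑ i ∈ A.corrupted, cost c i (execution Z A ω) = Z.rounds * (A.queries.card * c) := by
  rw [A.card_queries]
  push_cast
  rw [Finset.sum_mul, Finset.mul_sum]
  refine Finset.sum_congr rfl fun i hi => ?_
  rw [cost, queriesAsked_execution Z A ω hi]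
  push_cast
  ring

theorem RewardSchedule.card_segment_sum (W : RewardSchedule) (R : ℕ) (x : ℝ) :
    (R : ℝ) * x = ∑ j ∈ Finset.range (W.changes + 1), (W.segment R j).card * x := by
  simpa using W.sum_segment R fun _ => x

theorem rewardsMinusCost_execution_le {n q : ℕ} (Z : Environment n) (A : Adversary n q)
    (W : RewardSchedule) (hw : ∀ j ≤ W.changes, 0 ≤ W.reward j) (c x : ℝ) (ω : Randomness Z A)
    (hω : ∀ j ≤ W.changes,
      (∑ a ∈ W.segment Z.rounds j ×ˢ A.queries, if ω.1 a = true then (1 : ℝ) else 0) ≤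
        x * (W.segment Z.rounds j ×ˢ A.queries).card) (j : Fin n) :
    rewardsMinusCost W c A.corrupted j (execution Z A ω) ≤
      ∑ j ∈ Finset.range (W.changes + 1),
        (W.segment Z.rounds j).card * (A.queries.card * (x * W.reward j - c)) := by
  have h1 := rewards_execution_le Z A W (fun m => hw _ (W.index_le m)) ω j
  rw [W.sum_segment] at h1
  have h2 : ∀ j ∈ Finset.range (W.changes + 1), ∑ m ∈ W.segment Z.rounds j,
      roundReward W.blockReward A m (fun i k => ω.1 (m, i, k)) ≤
        (W.segment Z.rounds j).card * (A.queries.card * (x * W.reward j)) := by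
    intro j hj
    have hj := Nat.le_of_lt_succ (Finset.mem_range.1 hj)
    have h := mul_le_mul_of_nonneg_left (hω j hj) (hw j hj)
    rw [Finset.sum_product, Finset.mul_sum, Finset.card_product] at h
    push_cast at h
    calc _ = _ := Finset.sum_congr rfl fun m hm => by
          rw [roundReward_eq, W.blockReward_of_mem_segment hm]
      _ ≤ _ := h
      _ = _ := by ring
  rw [rewardsMinusCost, sum_cost_execution, W.card_segment_sum]
  have h3 := h1.trans (Finset.sum_le_sum h2)
  have h4 := sub_le_sub_right h3 (∑ j ∈ Finset.range (W.changes + 1),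
    ((W.segment Z.rounds j).card : ℝ) * (A.queries.card * c))
  refine h4.trans_eq ?_
  rw [← Finset.sum_sub_distrib]
  exact Finset.sum_congr rfl fun _ _ => by ring

open Classical in
theorem le_rewardsMinusCost_execution {n q : ℕ} (Z : Environment n) (T : Finset (Fin n))
    (W : RewardSchedule) (hw : ∀ j ≤ W.changes, 0 ≤ W.reward j) (c x : ℝ)
    (ω : Randomness Z (followProtocol q T))
    (hω : ∀ j ≤ W.changes, (W.segment Z.rounds j).card * x ≤
      ∑ m ∈ W.segment Z.rounds j,
        if ∃ a ∈ T ×ˢ (Finset.univ : Finset (Fin q)), ω.1 (m, a) = true then (1 : ℝ) else 0)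
    (j : Fin n) :
    ∑ j ∈ Finset.range (W.changes + 1),
        (W.segment Z.rounds j).card * (x * W.reward j - (T.card * q : ℕ) * c) ≤
      rewardsMinusCost W c T j (execution Z (followProtocol q T) ω) := by
  have h1 := le_rewards_execution_followProtocol Z T W (fun m => hw _ (W.index_le m)) ω j
  rw [W.sum_segment] at h1
  have h2 : ∀ j ∈ Finset.range (W.changes + 1),
      (W.segment Z.rounds j).card * (x * W.reward j) ≤ ∑ m ∈ W.segment Z.rounds j,
        if ∃ i ∈ T, ∃ k, ω.1 (m, i, k) = true then W.blockReward m else 0 := by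
    intro j hj
    have hj := Nat.le_of_lt_succ (Finset.mem_range.1 hj)
    have h := mul_le_mul_of_nonneg_left (hω j hj) (hw j hj)
    rw [Finset.mul_sum] at h
    calc _ = _ := by ring
      _ ≤ _ := h
      _ = _ := Finset.sum_congr rfl fun m hm => by
          rw [W.blockReward_of_mem_segment hm]
          simp
  have hcost := sum_cost_execution Z (followProtocol q T) ω c
  rw [card_queries_followProtocol, W.card_segment_sum] at hcost
  have hc : ∑ i ∈ T, cost c i (execution Z (followProtocol q T) ω) = _ := hcost
  rw [rewardsMinusCost, hc]
  have h3 := (Finset.sum_le_sum h2).trans h1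
  have h4 := sub_le_sub_right h3 (∑ j ∈ Finset.range (W.changes + 1),
    ((W.segment Z.rounds j).card : ℝ) * ((T.card * q : ℕ) * c))
  refine le_trans (le_of_eq ?_) h4
  rw [← Finset.sum_sub_distrib]
  exact Finset.sum_congr rfl fun _ _ => by ring

/-! ### The comparison of the two executions -/

/-- Let `y` be the lower reward rate per query and `E = 4 * δ * (1 + s) + s`. The cost condition
reads `c ≤ φ * y`, so `(1 - φ) * y ≤ y - c`. With `(1 + δ) * p * w ≤ (1 + E) * y`, the gain over `y
- c` is at most `E * y ≤ E / (1 - φ) * (y - c)`. -/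
theorem utility_gain_le {p w c a s φ δ : ℝ} (hpw : 0 ≤ p * w) (ha : 0 ≤ a) (has : a ≤ s)
    (hφ1 : φ < 1) (hδ0 : 0 < δ) (hδ1 : δ < 1 / 4)
    (hc : c ≤ p * w * (1 - δ) * φ / (1 + a)) :
    0 ≤ (1 - δ) * p * w / (1 + a) - c ∧ 0 ≤ (1 + δ) * p * w - c ∧
    (1 + δ) * p * w - c ≤
      (1 + (4 * δ * (1 + s) + s) / (1 - φ)) * ((1 - δ) * p * w / (1 + a) - c) := by
  have ha1 : 0 < 1 + a := by linarith
  set y := (1 - δ) * p * w / (1 + a) with hy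
  have hpy : (1 - δ) * (p * w) = y * (1 + a) := by
    rw [hy]
    field_simp
  have hy0 : 0 ≤ y := by
    rw [hy, mul_assoc]
    exact div_nonneg (mul_nonneg (by linarith) hpw) ha1.le
  have hcy : c ≤ φ * y := by
    refine hc.trans_eq ?_
    rw [hy]
    ring
  have h1 : (1 - φ) * y ≤ y - c := by linarith
  have h2 : 0 ≤ y - c := le_trans (mul_nonneg (by linarith) hy0) h1
  have hE : 0 ≤ 4 * δ * (1 + s) + s := by nlinarith
  set E := 4 * δ * (1 + s) + s with hEdef
  have h3 : E * y ≤ E / (1 - φ) * (y - c) := by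
    rw [div_mul_eq_mul_div, le_div_iff₀ (by linarith)]
    nlinarith
  -- `E` is chosen so that `1 + E = (1 + s) * (1 + 4 * δ)`, and `(1 + 4 * δ) * (1 - δ)` exceeds `1 +
  -- δ` by `2 * δ * (1 - 2 * δ)`.
  have h4 : (1 + δ) * (1 + a) ≤ (1 + E) * (1 - δ) := by
    have : (1 + E) * (1 - δ) - (1 + δ) * (1 + s) = 2 * δ * (1 + s) * (1 - 2 * δ) := by
      rw [hEdef]
      ring
    have : 0 ≤ 2 * δ * (1 + s) * (1 - 2 * δ) :=
      mul_nonneg (mul_nonneg (by linarith) (by linarith)) (by linarith)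
    nlinarith
  have h5 : (1 + δ) * (p * w) ≤ (1 + E) * y := by
    have := mul_le_mul_of_nonneg_right h4 hpw
    refine le_of_mul_le_mul_right ?_ ha1
    calc (1 + δ) * (p * w) * (1 + a) = (1 + δ) * (1 + a) * (p * w) := by ring
      _ ≤ (1 + E) * (1 - δ) * (p * w) := this
      _ = (1 + E) * y * (1 + a) := by rw [mul_assoc, hpy]; ring
  refine ⟨h2, ?_, by linarith⟩
  have h6 : y ≤ (1 + δ) * (p * w) := by nlinarith
  linarith

/-- Some participant must lie outside `T`: a real supremum over an empty type would be `0`. -/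
theorem Utility.max_le {n : ℕ} (U : Utility n) {T : Finset (Fin n)} (hT : T.card < n)
    {st : State n} {x : ℝ} (h : ∀ j, U T j st ≤ x) : U.max T st ≤ x := by
  obtain ⟨j, hj⟩ : ∃ j, j ∉ T := by
    by_contra! hall
    exact hT.ne (by rw [Finset.eq_univ_of_forall hall, Finset.card_univ, Fintype.card_fin])
  have : Nonempty {j : Fin n // j ∉ T} := ⟨⟨j, hj⟩⟩
  exact ciSup_le fun j => h j

theorem Utility.le_min {n : ℕ} (U : Utility n) {T : Finset (Fin n)} (hT : T.card < n)
    {st : State n} {x : ℝ} (h : ∀ j, x ≤ U T j st) : x ≤ U.min T st := by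
  obtain ⟨j, hj⟩ : ∃ j, j ∉ T := by
    by_contra! hall
    exact hT.ne (by rw [Finset.eq_univ_of_forall hall, Finset.card_univ, Fintype.card_fin])
  have : Nonempty {j : Fin n // j ∉ T} := ⟨⟨j, hj⟩⟩
  exact le_ciInf fun j => h j

/-! ### Probability of the exceptional events -/

instance (N : ℕ) : IsProbabilityMeasure (fairCoins N) := by
  unfold fairCoins
  infer_instance

theorem law_eq {n q : ℕ} (p : unitInterval) (Z : Environment n) (A : Adversary n q) :
    law p Z A = (oracleLaw _ p).prod ((fairCoins Z.coins).prod (fairCoins A.coins)) := rfl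

instance {n q : ℕ} (p : unitInterval) (Z : Environment n) (A : Adversary n q) :
    IsProbabilityMeasure (law p Z A) := by
  rw [law_eq]
  infer_instance

/-- The exceptional events depend only on the oracle answers of one execution, so all coins and the
other execution integrate out. -/
theorem law_prod_law_real_fst {n q : ℕ} (p : unitInterval) (Z : Environment n)
    (A A' : Adversary n q) (S : Set (Fin Z.rounds × Fin n × Fin q → Bool)) :
    ((law p Z A).prod (law p Z A')).real {ω | ω.1.1 ∈ S} = (oracleLaw _ p).real S := by
  have h : MeasurePreserving (fun ω : Randomness Z A × Randomness Z A' => ω.1.1)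
      ((law p Z A).prod (law p Z A')) (oracleLaw _ p) :=
    MeasurePreserving.comp (μb := law p Z A) measurePreserving_fst measurePreserving_fst
  exact congrArg ENNReal.toReal (h.measure_preimage S.to_countable.measurableSet.nullMeasurableSet)

theorem law_prod_law_real_snd {n q : ℕ} (p : unitInterval) (Z : Environment n)
    (A A' : Adversary n q) (S : Set (Fin Z.rounds × Fin n × Fin q → Bool)) :
    ((law p Z A).prod (law p Z A')).real {ω | ω.2.1 ∈ S} = (oracleLaw _ p).real S := by
  have h : MeasurePreserving (fun ω : Randomness Z A × Randomness Z A' => ω.2.1)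
      ((law p Z A).prod (law p Z A')) (oracleLaw _ p) :=
    MeasurePreserving.comp (μb := law p Z A') measurePreserving_fst measurePreserving_snd
  exact congrArg ENNReal.toReal (h.measure_preimage S.to_countable.measurableSet.nullMeasurableSet)

/-- The exponent is weakened by `1 / (1 + a)` so that both tails share one bound. -/
theorem oracleLaw_segment_gt_le {n q R : ℕ} (p : unitInterval) {a δ L : ℝ} (ha : 0 ≤ a)
    (hδ : 0 ≤ δ) (K : Finset (Fin R)) (hK : L ≤ K.card) (S : Finset (Fin n × Fin q)) :
    (oracleLaw (Fin R × Fin n × Fin q) p).real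
      {ω | (1 + δ) * (p : ℝ) * (K ×ˢ S).card < ∑ x ∈ K ×ˢ S, if ω x = true then (1 : ℝ) else 0} ≤
      Real.exp (-(2 * (δ * p / (1 + a)) ^ 2 * L)) := by
  have hp := p.2.1
  -- Without queries Hoeffding's bound is only `1`, but the event is the strict inequality `0 < 0`,
  -- hence empty.
  rcases S.eq_empty_or_nonempty with rfl | hS
  · simpa using (Real.exp_pos _).le
  · refine (oracleLaw_sum_gt_le p (K ×ˢ S) hδ).trans (Real.exp_le_exp.2 (neg_le_neg ?_))
    have h1 : (δ * p / (1 + a)) ^ 2 ≤ (δ * p) ^ 2 :=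
      pow_le_pow_left₀ (by positivity) (div_le_self (by positivity) (by linarith)) 2
    have h2 : L ≤ (K ×ˢ S).card := by
      refine hK.trans ?_
      rw [Finset.card_product]
      exact_mod_cast Nat.le_mul_of_pos_right _ hS.card_pos
    calc 2 * (δ * p / (1 + a)) ^ 2 * L ≤ 2 * (δ * p / (1 + a)) ^ 2 * (K ×ˢ S).card := by gcongr
      _ ≤ _ := by gcongr

open Classical in
theorem oracleLaw_segment_lt_le {n q R : ℕ} (p : unitInterval) {a δ L : ℝ} (ha : 0 ≤ a)
    (hδ : 0 ≤ δ) (K : Finset (Fin R)) (hK : L ≤ K.card) (S : Finset (Fin n × Fin q))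
    (hS : (p : ℝ) * S.card ≤ a) :
    (oracleLaw (Fin R × Fin n × Fin q) p).real
      {ω | (∑ m ∈ K, if ∃ x ∈ S, ω (m, x) = true then (1 : ℝ) else 0) <
        K.card * ((1 - δ) * p * S.card / (1 + a))} ≤
      Real.exp (-(2 * (δ * p / (1 + a)) ^ 2 * L)) := by
  have hp := p.2.1
  rcases S.eq_empty_or_nonempty with rfl | hne
  · simpa using (Real.exp_pos _).le
  · have h1 : (p : ℝ) * S.card / (1 + a) ≤ 1 - (1 - (p : ℝ)) ^ S.card := by
      refine le_trans ?_ (le_one_sub_one_sub_pow p.2 S.card)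
      gcongr
    have h := oracleLaw_sum_exists_lt_le p S K (η := δ * ((p : ℝ) * S.card / (1 + a)))
      (by positivity) h1
    have h2 : (p : ℝ) * S.card / (1 + a) - δ * ((p : ℝ) * S.card / (1 + a)) =
      (1 - δ) * p * S.card / (1 + a) := by ring
    rw [h2] at h
    refine h.trans (Real.exp_le_exp.2 (neg_le_neg ?_))
    have h3 : (1 : ℝ) ≤ S.card := by exact_mod_cast hne.card_pos
    have h4 : δ * p / (1 + a) ≤ δ * ((p : ℝ) * S.card / (1 + a)) := by
      rw [← mul_div_assoc, ← mul_assoc]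
      exact div_le_div_of_nonneg_right (le_mul_of_one_le_right (by positivity) h3) (by linarith)
    calc 2 * (δ * p / (1 + a)) ^ 2 * L ≤ 2 * (δ * p / (1 + a)) ^ 2 * K.card := by gcongr
      _ ≤ _ := by gcongr

/-- Outside two exceptional events per reward period, the utilities can be compared period by period
with `utility_gain_le`. -/
theorem failure_le {n q : ℕ} (p : unitInterval) {c L a s φ δ : ℝ} (hL : 0 < L)
    (Z : Environment n) (A : Adversary n q) (W : RewardSchedule)
    (hW : W.ChangesEvery L Z.rounds) (hT : A.corrupted.card < n) (ha : 0 ≤ a) (has : a ≤ s)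
    (hTa : (p : ℝ) * (A.corrupted.card * q : ℕ) ≤ a) (hφ1 : φ < 1) (hδ0 : 0 < δ)
    (hδ1 : δ < 1 / 4) (hw : ∀ j ≤ W.changes, 0 ≤ W.reward j)
    (hc : ∀ j ≤ W.changes, c ≤ p * W.reward j * (1 - δ) * φ / (1 + a)) :
    ((law p Z (followProtocol q A.corrupted)).prod (law p Z A)).real
      {ω | ¬ (rewardsMinusCost W c).max A.corrupted (execution Z A ω.2) ≤
        (rewardsMinusCost W c).min A.corrupted
            (execution Z (followProtocol q A.corrupted) ω.1)
          + (4 * δ * (1 + s) + s) / (1 - φ) * |(rewardsMinusCost W c).min A.corrupted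
              (execution Z (followProtocol q A.corrupted) ω.1)| + 0} ≤
      (Z.rounds + 1) * (2 * Real.exp (-(2 * (δ * p / (1 + a)) ^ 2 * L))) := by
  classical
  set T := A.corrupted with hTdef
  set N := T.card * q with hN
  set B := 2 * Real.exp (-(2 * (δ * p / (1 + a)) ^ 2 * L)) with hB
  set μ := (law p Z (followProtocol q T)).prod (law p Z A)
  let K := fun j => W.segment Z.rounds j
  let S := T ×ˢ (Finset.univ : Finset (Fin q))
  have hS : S.card = N := by simp [S, hN]
  let bad₁ : ℕ → Set (Fin Z.rounds × Fin n × Fin q → Bool) := fun j =>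
    {ω | (∑ m ∈ K j, if ∃ x ∈ S, ω (m, x) = true then (1 : ℝ) else 0) <
        (K j).card * ((1 - δ) * p * S.card / (1 + a))}
  let bad₂ : ℕ → Set (Fin Z.rounds × Fin n × Fin q → Bool) := fun j =>
    {ω | (1 + δ) * p * (K j ×ˢ A.queries).card <
      ∑ x ∈ K j ×ˢ A.queries, if ω x = true then (1 : ℝ) else 0}
  have hbad : ∀ j ∈ Finset.range (W.changes + 1),
      μ.real ({ω | ω.1.1 ∈ bad₁ j} ∪ {ω | ω.2.1 ∈ bad₂ j}) ≤ B := by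
    intro j hj
    have hKj := hW.le_card_segment hL (Nat.le_of_lt_succ (Finset.mem_range.1 hj))
    refine (measureReal_union_le _ _).trans ?_
    rw [law_prod_law_real_fst, law_prod_law_real_snd, hB, two_mul]
    exact add_le_add
      (oracleLaw_segment_lt_le p ha hδ0.le (K j) hKj S (by rw [hS]; exact hTa))
      (oracleLaw_segment_gt_le p ha hδ0.le (K j) hKj A.queries)
  have hsub : {ω : Randomness Z (followProtocol q T) × Randomness Z A |
      ¬ (rewardsMinusCost W c).max T (execution Z A ω.2) ≤
        (rewardsMinusCost W c).min T (execution Z (followProtocol q T) ω.1)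
          + (4 * δ * (1 + s) + s) / (1 - φ) * |(rewardsMinusCost W c).min T
              (execution Z (followProtocol q T) ω.1)| + 0} ⊆
      ⋃ j ∈ Finset.range (W.changes + 1), ({ω | ω.1.1 ∈ bad₁ j} ∪ {ω | ω.2.1 ∈ bad₂ j}) := by
    intro ω hω
    by_contra hgood
    simp only [Set.mem_iUnion, not_exists, Set.mem_union, not_or] at hgood
    refine hω ?_
    have hup : (rewardsMinusCost W c).max T (execution Z A ω.2) ≤ _ :=
      Utility.max_le _ hT (rewardsMinusCost_execution_le Z A W hw c ((1 + δ) * p) ω.2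
        fun j hj => not_lt.1 (hgood j (Finset.mem_range.2 (Nat.lt_succ_of_le hj))).2)
    have hlow := Utility.le_min (rewardsMinusCost W c) hT
      (le_rewardsMinusCost_execution Z T W hw c ((1 - δ) * p * S.card / (1 + a)) ω.1
        fun j hj => not_lt.1 (hgood j (Finset.mem_range.2 (Nat.lt_succ_of_le hj))).1)
    set m := (rewardsMinusCost W c).min T (execution Z (followProtocol q T) ω.1)
    set ε := (4 * δ * (1 + s) + s) / (1 - φ) with hε
    have hε0 : 0 ≤ ε := div_nonneg (by nlinarith) (by linarith)
    have hgain := fun j (hj : j ∈ Finset.range (W.changes + 1)) =>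
      have hj := Nat.le_of_lt_succ (Finset.mem_range.1 hj)
      utility_gain_le (mul_nonneg p.2.1 (hw j hj)) ha has hφ1 hδ0 hδ1 (hc j hj)
    have hlow_eq : ∀ j, ((1 - δ) * p * S.card / (1 + a) * W.reward j - (N : ℝ) * c) =
        N * ((1 - δ) * p * W.reward j / (1 + a) - c) := by
      intro j
      rw [hS]
      ring
    simp only [← hN, hlow_eq] at hlow
    -- Following the protocol is profitable in each period, so the absolute value disappears.
    have hm : 0 ≤ m := le_trans (Finset.sum_nonneg fun j hj =>
      mul_nonneg (Nat.cast_nonneg _) (mul_nonneg (Nat.cast_nonneg _) (hgain j hj).1)) hlow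
    rw [abs_of_nonneg hm, add_zero]
    calc _ ≤ _ := hup
      _ ≤ (1 + ε) * ∑ j ∈ Finset.range (W.changes + 1), ((K j).card : ℝ) *
          (N * ((1 - δ) * p * W.reward j / (1 + a) - c)) := by
        rw [Finset.mul_sum]
        refine Finset.sum_le_sum fun j hj => ?_
        obtain ⟨-, h1, h2⟩ := hgain j hj
        -- The adversary may ask fewer queries than `N`; as the upper rate `(1 + δ) * p * w - c` is
        -- nonnegative, asking all of them only raises the bound.
        have hQ : (A.queries.card : ℝ) ≤ N := by exact_mod_cast A.card_queries_le
        calc _ ≤ ((K j).card : ℝ) * (N * ((1 + δ) * p * W.reward j - c)) := by gcongr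
          _ ≤ ((K j).card : ℝ) * (N * ((1 + ε) *
              ((1 - δ) * p * W.reward j / (1 + a) - c))) := by gcongr
          _ = _ := by ring
      _ ≤ (1 + ε) * m := by gcongr
      _ = _ := by ring
  calc _ ≤ _ := measureReal_mono hsub (measure_ne_top _ _)
    _ ≤ _ := measureReal_biUnion_finset_le _ _
    _ ≤ _ := Finset.sum_le_card_nsmul _ _ _ hbad
    _ ≤ _ := by
      rw [Finset.card_range, nsmul_eq_mul]
      have : W.changes ≤ Z.rounds := hW.changes_le hL
      push_cast
      gcongr

theorem superpolynomialDecay_exp_neg_mul {C : ℝ} (hC : 0 < C) :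
    Asymptotics.SuperpolynomialDecay Filter.atTop (fun κ : ℕ => (κ : ℝ))
      fun κ : ℕ => Real.exp (-(C * κ)) := by
  intro N
  have h := (tendsto_rpow_mul_exp_neg_mul_atTop_nhds_zero N C hC).comp
    tendsto_natCast_atTop_atTop
  simpa [Function.comp_def] using h

end BitcoinEVP

/-! ### Negligible failure probability -/

theorem mainTheorem4 (n q : ℕ) (hn : 1 ≤ n) (p : unitInterval) (c : ℝ) (hc : 0 ≤ c)
    (r : ℕ → ℕ) (W : ℕ → BitcoinEVP.RewardSchedule) (l : ℝ) (hl : 0 < l)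
    (hW : ∀ κ : ℕ, 1 ≤ κ → (W κ).ChangesEvery (l * κ) (r κ))
    (s : ℝ) (hs : s = BitcoinEVP.expectedSolutions n q p)
    (φ : ℝ) (hφ : φ ∈ Set.Ioo 0 (1 - s))
    (hcost : ∀ κ : ℕ, 1 ≤ κ → ∀ j ≤ (W κ).changes,
      c < p * (W κ).reward j * φ / (1 + p * q * ((n : ℝ) - 1)))
    (δ₁ : ℝ) (hδ₁ : δ₁ ∈ Set.Ioo (0 : ℝ) 0.25)
    (hcost' : ∀ κ : ℕ, 1 ≤ κ → ∀ j ≤ (W κ).changes,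
      c ≤ p * (W κ).reward j * (1 - δ₁) * φ / (1 + p * q * ((n : ℝ) - 1)))
    (hsum : 4 * δ₁ * (1 + s) + s < 1 - φ) :
    BitcoinEVP.IsEVP n q p r (fun κ => BitcoinEVP.rewardsMinusCost (W κ) c) (n - 1)
      ((4 * δ₁ * (1 + s) + s) / (1 - φ)) 0 := by
  intro A hA Z hZ
  have hn' : (1 : ℝ) ≤ n := by exact_mod_cast hn
  have hp := p.2.1
  set a : ℝ := p * q * ((n : ℝ) - 1) with ha
  have ha0 : 0 ≤ a := mul_nonneg (by positivity) (by linarith)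
  have has : a ≤ s := by
    rw [hs, BitcoinEVP.expectedSolutions, ha]
    gcongr
    linarith
  have hpos : ∀ κ : ℕ, 1 ≤ κ → ∀ j ≤ (W κ).changes, 0 < p * (W κ).reward j := by
    intro κ hκ j hj
    have h := hc.trans_lt (hcost κ hκ j hj)
    rw [div_pos_iff_of_pos_right (by linarith)] at h
    exact pos_of_mul_pos_left h hφ.1.le
  -- The strict cost bound forces `p * w₀ > 0`, and with `p > 0` the decay rate `C` is positive.
  have hp0 : 0 < (p : ℝ) := by
    refine hp.lt_of_ne' fun h => ?_
    simpa [h] using hpos 1 le_rfl 0 (Nat.zero_le _)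
  obtain ⟨P, hP⟩ := hZ.polynomial
  set C := 2 * (δ₁ * p / (1 + a)) ^ 2 * l with hC
  have hC0 : 0 < C := by
    have := hδ₁.1
    positivity
  -- The factor `2 * (P + 1)` is the union bound: two events for each of at most `r κ + 1` periods.
  have hdecay := (BitcoinEVP.superpolynomialDecay_exp_neg_mul hC0).polynomial_mul
    (2 * (P + 1))
  refine (Asymptotics.superpolynomialDecay_zero _ _).trans_eventuallyLE ?_ hdecay ?_ ?_
  · exact .of_forall fun κ => Nat.cast_nonneg κ
  · exact .of_forall fun κ => measureReal_nonneg
  · filter_upwards [Filter.eventually_ge_atTop 1] with κ hκ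
    have hr : (Z κ).rounds = r κ := hZ.rounds κ hκ
    have hTn : (A κ).corrupted.card + 1 ≤ n := by
      have := hA κ
      omega
    have hTn' : ((A κ).corrupted.card : ℝ) ≤ n - 1 := by
      have : (((A κ).corrupted.card + 1 : ℕ) : ℝ) ≤ n := by exact_mod_cast hTn
      push_cast at this
      linarith
    have key := BitcoinEVP.failure_le p (c := c) (L := l * κ) (a := a) (s := s) (φ := φ) (δ := δ₁)
      (by positivity) (Z κ) (A κ) (W κ) (hr ▸ hW κ hκ) (by omega) ha0 has ?_
      (by linarith [hφ.2]) hδ₁.1 (hδ₁.2.trans_eq (by norm_num))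
      (fun j hj => (pos_of_mul_pos_right (hpos κ hκ j hj) hp).le) (hcost' κ hκ)
    · refine key.trans_eq ?_
      rw [hr, hP κ hκ]
      simp only [Polynomial.eval_mul, Polynomial.eval_add, Polynomial.eval_ofNat,
        Polynomial.eval_one]
      rw [hC]
      ring_nf
    · push_cast
      rw [ha]
      calc (p : ℝ) * ((A κ).corrupted.card * q) = p * q * (A κ).corrupted.card := by ring
        _ ≤ _ := by gcongr
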